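/- Let $d\ge 1$, let $A\in GL_d(\mathbb{Q})$ be a matrix with no complex eigenvalue of norm $1$, and let $\mathbb{Z}\ltimes_A\mathbb{Q}^d$ be the semidirect product in which the generator $a$ of $\mathbb{Z}$ acts on $\mathbb{Q}^d$ by $a v a^{-1}=Av$. Let $G$ be a subgroup of $\mathbb{Z}\ltimes_A\mathbb{Q}^d$ of the form $G=\mathbb{Z}\ltimes_A H$, where $H\subset\mathbb{Q}^d$ is an additive subgroup of $\mathbb{Q}$-rank $d$ (that is, $H$ spans $\mathbb{Q}^d$ over $\mathbb{Q}$; $H$ is then invariant under $A$ and $A^{-1}$). Let $\rho: G\to \mathrm{Diff}^1_+(\mathrm{S}^1)$ be a homomorphism into the group of orientation-preserving $C^1$ diffeomorphisms of the circle, and assume that the image $\rho(G)$ is non-Abelian. Then the action of $G$ on $\mathrm{S}^1$ defined by $\rho$ has a finite orbit. In particular, the action has no exceptional minimal set, that is, no subset of $\mathrm{S}^1$ that is homeomorphic to the Cantor set and minimal, with respect to inclusion, among the nonempty closed $G$-invariant subsets of $\mathrm{S}^1$. -/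

import Mathlib

/-! ### The group `ℤ ⋉_A ℚ^d` -/

/-- The automorphism `v ↦ A v` of (the multiplicatively written) group `ℚ^d`. -/
def matrixMulAut {d : ℕ} (A : GL (Fin d) ℚ) : MulAut (Multiplicative (Fin d → ℚ)) where
  toFun v := Multiplicative.ofAdd ((A : Matrix (Fin d) (Fin d) ℚ).mulVec v.toAdd)
  invFun v := Multiplicative.ofAdd (((A⁻¹ : GL (Fin d) ℚ) : Matrix (Fin d) (Fin d) ℚ).mulVec v.toAdd)
  left_inv v := by
    simp only [toAdd_ofAdd, Matrix.mulVec_mulVec, ← Units.val_mul, inv_mul_cancel]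
    simp
  right_inv v := by
    simp only [toAdd_ofAdd, Matrix.mulVec_mulVec, ← Units.val_mul, mul_inv_cancel]
    simp
  map_mul' v w := by
    simp only [toAdd_mul, Matrix.mulVec_add, ofAdd_add]

/-- The semidirect product `ℤ ⋉_A ℚ^d`: the generator `a` of the factor `ℤ` acts on `ℚ^d` by
`a v a⁻¹ = A v`. For `g` in this group, `g.left` is the component in `ℚ^d` and `g.right` the
component in `ℤ`. -/
abbrev ZSemidirect {d : ℕ} (A : GL (Fin d) ℚ) : Type :=
  Multiplicative (Fin d → ℚ) ⋊[zpowersHom (MulAut (Multiplicative (Fin d → ℚ))) (matrixMulAut A)]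
    Multiplicative ℤ

/-- The subgroup `G` of `ℤ ⋉_A ℚ^d` is of the form `ℤ ⋉_A H`: as a set, it is the set of all
elements whose `ℚ^d`-component lies in `H`. (Then `H` is necessarily invariant under `A` and
`A⁻¹`, because `G` is a subgroup.) -/
def IsZSemidirectWith {d : ℕ} {A : GL (Fin d) ℚ} (G : Subgroup (ZSemidirect A))
    (H : AddSubgroup (Fin d → ℚ)) : Prop :=
  ∀ g : ZSemidirect A, g ∈ G ↔ g.left.toAdd ∈ H

/-- The matrix `A` has no complex eigenvalue of norm `1`. -/
def NoEigenvalueOfNormOne {d : ℕ} (A : GL (Fin d) ℚ) : Prop :=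
  ∀ z : ℂ, Module.End.HasEigenvalue
    (Matrix.toLin' ((A : Matrix (Fin d) (Fin d) ℚ).map (algebraMap ℚ ℂ))) z → ‖z‖ ≠ 1

/-! ### Orientation-preserving `C^1` diffeomorphisms of the circle `ℝ / ℤ` -/

/-- The circle map `f` is of class `C^1` and lifts to an increasing map of the line: there is a
strictly increasing map `F : ℝ → ℝ` of class `C^1`, commuting with `x ↦ x + 1`, such that
`f (x mod ℤ) = F x mod ℤ`. -/
def HasIncreasingC1Lift (f : UnitAddCircle → UnitAddCircle) : Prop :=
  ∃ F : ℝ → ℝ, ContDiff ℝ 1 F ∧ StrictMono F ∧ (∀ x, F (x + 1) = F x + 1) ∧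
    ∀ x : ℝ, f (x : UnitAddCircle) = (F x : UnitAddCircle)

theorem HasIncreasingC1Lift.comp {f g : UnitAddCircle → UnitAddCircle}
    (hf : HasIncreasingC1Lift f) (hg : HasIncreasingC1Lift g) : HasIncreasingC1Lift (f ∘ g) := by
  obtain ⟨F, hF1, hF2, hF3, hF4⟩ := hf
  obtain ⟨K, hK1, hK2, hK3, hK4⟩ := hg
  exact ⟨F ∘ K, hF1.comp hK1, hF2.comp hK2, fun x => by simp [hK3, hF3],
    fun x => by simp [hK4, hF4]⟩

theorem HasIncreasingC1Lift.id : HasIncreasingC1Lift id :=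
  ⟨_root_.id, contDiff_id, strictMono_id, fun _ => rfl, fun _ => rfl⟩

/-- The group `Diff^1_+(S^1)` of orientation-preserving `C^1` diffeomorphisms of the circle
`S^1 = ℝ / ℤ`: the bijections `f` such that `f` and `f⁻¹` are of class `C^1` and preserve the
orientation. -/
def DiffOnePlusCircle : Subgroup (Equiv.Perm UnitAddCircle) where
  carrier := {f | HasIncreasingC1Lift f ∧ HasIncreasingC1Lift (f⁻¹ : Equiv.Perm UnitAddCircle)}
  mul_mem' {f g} hf hg := by
    refine ⟨?_, ?_⟩
    · rw [Equiv.Perm.coe_mul]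
      exact hf.1.comp hg.1
    · rw [mul_inv_rev, Equiv.Perm.coe_mul]
      exact hg.2.comp hf.2
  one_mem' := by
    refine ⟨?_, ?_⟩
    · rw [Equiv.Perm.coe_one]
      exact HasIncreasingC1Lift.id
    · rw [inv_one, Equiv.Perm.coe_one]
      exact HasIncreasingC1Lift.id
  inv_mem' {f} hf := ⟨hf.2, by rw [inv_inv]; exact hf.1⟩

/-! ### Orbits and minimal sets of an action on the circle -/

/-- The orbit of the point `x` under the action `ρ`. -/
def circleOrbit {G : Type*} [Group G] (ρ : G →* DiffOnePlusCircle) (x : UnitAddCircle) :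
    Set UnitAddCircle :=
  Set.range fun g : G => (ρ g : Equiv.Perm UnitAddCircle) x

/-- `K` is a minimal set of the action `ρ`: it is minimal for inclusion among the nonempty closed
invariant subsets of the circle. -/
def IsMinimalSet {G : Type*} [Group G] (ρ : G →* DiffOnePlusCircle)
    (K : Set UnitAddCircle) : Prop :=
  Minimal (fun S : Set UnitAddCircle => S.Nonempty ∧ IsClosed S ∧
    ∀ g : G, ∀ x ∈ S, (ρ g : Equiv.Perm UnitAddCircle) x ∈ S) K

/-- `K` is an exceptional minimal set of the action `ρ`: a minimal set that is homeomorphic to the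
Cantor set. -/
def IsExceptionalMinimalSet {G : Type*} [Group G] (ρ : G →* DiffOnePlusCircle)
    (K : Set UnitAddCircle) : Prop :=
  IsMinimalSet ρ K ∧ Nonempty (K ≃ₜ cantorSet)

/-! Let `a` generate `ℤ`. Rotation number is additive on the Abelian group `H` and invariant under
conjugation by `a`, so it vanishes on `(A - 1)H`. Since `1` is not an eigenvalue of `A`, this group
contains `mH` for some `m > 0` (`exists_nsmul_eq_apply`). The elements of rotation number zero
therefore still span `ℚ^d`, and their lifts of translation number zero act on the line with common
fixed points (`LiftedAction.exists_fixed`). If they act trivially, `a` commutes with `H` and the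
image is Abelian. Otherwise the common fixed set has a gap `(p, q)`.

The core is `LiftedAction.not_gap`: a gap forces `a` to have a periodic point on the circle. If it
had none, the images of the gap would be disjoint modulo `1`, so their lengths would tend to zero
and the derivatives of `H` along the orbit of `p` would tend to `1` in both time directions. Their
logarithms form an orbit of the transpose of `A`, run backwards; a nonzero orbit of a hyperbolic map
cannot decay in both directions, so all these derivatives equal `1`. Displacements `h x - x` near
the orbit are then additive in `h` to first order. Divided by the derivative of `a ^ n` at `x`, they
form a pseudo-orbit of the transpose, which grows exponentially in one direction
(`growth_of_pseudoOrbit`). Displacements are bounded, so the derivative of `a ^ n` at `x` decays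
exponentially in that direction, and this contraction creates a periodic point
(`C1Lift.exists_periodic_of_contraction`), a contradiction.

When `a` has a periodic point, the supremum of a bounded orbit of `p` is periodic under `a` and
fixed by the elements of rotation number zero. Its full orbit is finite because `H` has finitely
many rotation numbers. Finally, a finite orbit forces every minimal set to be finite
(`IsMinimalSet.finite_of_finite_orbit`). -/

open Filter Topology

/-! ### Lifts of circle diffeomorphisms to the line -/

/-- The group of `C^1` diffeomorphisms of the line that are increasing and commute with
`x ↦ x + 1`. -/
def C1Lift : Subgroup CircleDeg1Liftˣ where
  carrier := {F | ContDiff ℝ 1 F ∧ ContDiff ℝ 1 (F⁻¹ : CircleDeg1Liftˣ)}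
  mul_mem' {F K} hF hK := by
    refine ⟨?_, ?_⟩
    · rw [Units.val_mul, CircleDeg1Lift.coe_mul]
      exact hF.1.comp hK.1
    · rw [mul_inv_rev, Units.val_mul, CircleDeg1Lift.coe_mul]
      exact hK.2.comp hF.2
  one_mem' := by
    refine ⟨?_, ?_⟩
    · rw [Units.val_one, CircleDeg1Lift.coe_one]
      exact contDiff_id
    · rw [inv_one, Units.val_one, CircleDeg1Lift.coe_one]
      exact contDiff_id
  inv_mem' {F} hF := ⟨hF.2, by rw [inv_inv]; exact hF.1⟩

namespace CircleDeg1Lift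

theorem units_mul_apply (F K : CircleDeg1Liftˣ) (x : ℝ) : (F * K) x = F (K x) := rfl

theorem units_strictMono (F : CircleDeg1Liftˣ) : StrictMono F :=
  (toOrderIso F).strictMono

theorem units_injective (F : CircleDeg1Liftˣ) : Function.Injective F :=
  (toOrderIso F).injective

theorem units_continuous (F : CircleDeg1Liftˣ) : Continuous F :=
  (toOrderIso F).continuous

theorem units_ext {F K : CircleDeg1Liftˣ} (h : ∀ x, F x = K x) : F = K :=
  Units.ext (CircleDeg1Lift.ext h)

theorem units_inv_apply_eq_iff (F : CircleDeg1Liftˣ) (x y : ℝ) : (F⁻¹) x = y ↔ x = F y := by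
  constructor
  · rintro rfl; simp
  · rintro rfl; simp

/-- A unit that fixes `x` has all its powers fixing `x`. -/
theorem units_zpow_fixed {F : CircleDeg1Liftˣ} {x : ℝ} (h : F x = x) (n : ℤ) :
    (F ^ n) x = x := by
  induction n using Int.induction_on with
  | zero => simp
  | succ n ih => rw [zpow_add_one, units_mul_apply, h, ih]
  | pred n ih => rw [zpow_sub_one, units_mul_apply, (units_inv_apply_eq_iff F x x).2 h.symm, ih]

theorem units_fixed_of_pow_fixed {F : CircleDeg1Liftˣ} {x : ℝ} {n : ℕ} (hn : 0 < n)
    (h : (F ^ n) x = x) : F x = x := by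
  have := (iterate_pos_eq_iff (f := (F : CircleDeg1Lift)) (x := x) (m := 0) hn).1 (by
    rw [← coe_pow, ← Units.val_pow_eq_pow_val, h]; simp)
  simpa using this

/-- The translation by the integer `k`. -/
noncomputable def intTranslate (k : ℤ) : CircleDeg1Liftˣ :=
  translate (Multiplicative.ofAdd (k : ℝ))

@[simp] theorem intTranslate_apply (k : ℤ) (x : ℝ) : intTranslate k x = k + x :=
  translate_apply _ _

theorem intTranslate_inv (k : ℤ) : (intTranslate k)⁻¹ = intTranslate (-k) := by
  rw [intTranslate, intTranslate, ← map_inv, ← ofAdd_neg]; simp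

theorem intTranslate_commute (k : ℤ) (F : CircleDeg1Liftˣ) : Commute (intTranslate k) F :=
  units_ext fun x => by simp

theorem translationNumber_intTranslate_mul (k : ℤ) (F : CircleDeg1Liftˣ) :
    translationNumber ((intTranslate k * F : CircleDeg1Liftˣ) : CircleDeg1Lift) =
      k + translationNumber (F : CircleDeg1Lift) := by
  rw [Units.val_mul, translationNumber_mul_of_commute]
  · rw [intTranslate, translationNumber_translate]
  · exact (intTranslate_commute k F).map (Units.coeHom _)

end CircleDeg1Lift

open CircleDeg1Lift

theorem intTranslate_mem_C1Lift (k : ℤ) : intTranslate k ∈ C1Lift := by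
  have h : ∀ k : ℤ, ContDiff ℝ 1 (intTranslate k) := fun k => by
    have : ((intTranslate k : CircleDeg1Lift) : ℝ → ℝ) = fun x => (k : ℝ) + x :=
      funext (intTranslate_apply k)
    rw [this]
    exact contDiff_const.add contDiff_id
  exact ⟨h k, by rw [intTranslate_inv]; exact h _⟩

/-! ### Derivatives of lifts: chain rule, periodicity, bounds. -/

section Derivative

variable {F K : CircleDeg1Liftˣ}

theorem C1Lift.differentiable (hF : F ∈ C1Lift) : Differentiable ℝ F :=
  hF.1.differentiable one_ne_zero

theorem C1Lift.continuous_deriv (hF : F ∈ C1Lift) : Continuous (deriv F) :=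
  hF.1.continuous_deriv le_rfl

theorem C1Lift.hasDerivAt (hF : F ∈ C1Lift) (x : ℝ) : HasDerivAt F (deriv F x) x :=
  (C1Lift.differentiable hF x).hasDerivAt

theorem C1Lift.deriv_mul (hF : F ∈ C1Lift) (hK : K ∈ C1Lift) (x : ℝ) :
    deriv (F * K : CircleDeg1Liftˣ) x = deriv F (K x) * deriv K x :=
  ((C1Lift.hasDerivAt hF (K x)).comp x (C1Lift.hasDerivAt hK x)).deriv

theorem deriv_units_one (x : ℝ) : deriv (1 : CircleDeg1Liftˣ) x = 1 :=
  (hasDerivAt_id x).deriv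

theorem C1Lift.deriv_pos (hF : F ∈ C1Lift) (x : ℝ) : 0 < deriv F x := by
  have h1 : 0 ≤ deriv F x := (units_strictMono F).monotone.deriv_nonneg
  refine h1.lt_of_ne fun h => ?_
  have h2 := C1Lift.deriv_mul (C1Lift.inv_mem hF) hF x
  rw [inv_mul_cancel, deriv_units_one, ← h, mul_zero] at h2
  exact one_ne_zero h2

theorem deriv_periodic (F : CircleDeg1Liftˣ) : Function.Periodic (deriv F) 1 := fun x => by
  have h : (fun y : ℝ => F (y + 1)) = fun y => F y + 1 := funext F.1.map_add_one
  rw [← deriv_comp_add_const, h, deriv_add_const]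

theorem C1Lift.deriv_bounded (hF : F ∈ C1Lift) : ∃ C, 0 < C ∧ ∀ x, deriv F x ≤ C := by
  obtain ⟨C, hC⟩ := ((deriv_periodic F).isBounded_of_continuous one_ne_zero
    (C1Lift.continuous_deriv hF)).exists_norm_le
  exact ⟨max C 1, by positivity, fun x =>
    (le_abs_self _).trans ((hC _ ⟨x, rfl⟩).trans (le_max_left _ _))⟩

theorem C1Lift.deriv_bounded_below (hF : F ∈ C1Lift) : ∃ c, 0 < c ∧ ∀ x, c ≤ deriv F x := by
  obtain ⟨C, hC0, hC⟩ := C1Lift.deriv_bounded (C1Lift.inv_mem hF)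
  refine ⟨C⁻¹, by positivity, fun x => ?_⟩
  have h2 := C1Lift.deriv_mul (C1Lift.inv_mem hF) hF x
  rw [inv_mul_cancel, deriv_units_one] at h2
  have h3 := hC (F x)
  have h4 := C1Lift.deriv_pos hF x
  rw [inv_le_iff_one_le_mul₀ hC0, h2, mul_comm]
  exact mul_le_mul_of_nonneg_left h3 h4.le

end Derivative

/-- A continuous periodic function on the line is uniformly continuous. -/
theorem Function.Periodic.uniformContinuous_of_continuous' {f : ℝ → ℝ}
    (hp : Function.Periodic f 1) (hf : Continuous f) : UniformContinuous f := by
  have h1 := isCompact_Icc (a := (-1 : ℝ)) (b := 2)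
    |>.uniformContinuousOn_of_continuous hf.continuousOn
  rw [Metric.uniformContinuousOn_iff] at h1
  rw [Metric.uniformContinuous_iff]
  intro ε hε
  obtain ⟨δ, hδ, h⟩ := h1 ε hε
  refine ⟨min δ 1, by positivity, fun {x y} hxy => ?_⟩
  have hx0 := Int.fract_nonneg x
  have hx1 := (Int.fract_lt_one x).le
  have e : ∀ z, f (z - ⌊x⌋) = f z := fun z => by
    simpa using hp.sub_int_mul_eq (x := z) ⌊x⌋
  have hd := lt_min_iff.1 hxy
  have hy : |x - y| < 1 := hd.2
  rw [abs_lt] at hy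
  rw [← e x, ← e y]
  have hfr : Int.fract x = x - ⌊x⌋ := rfl
  refine h _ ⟨by linarith, by linarith⟩ _ ⟨by linarith, by linarith⟩ ?_
  rw [Real.dist_eq, sub_sub_sub_cancel_right]
  exact hd.1

theorem C1Lift.uniformContinuous_deriv {F : CircleDeg1Liftˣ} (hF : F ∈ C1Lift) :
    UniformContinuous (deriv F) :=
  (deriv_periodic F).uniformContinuous_of_continuous' (C1Lift.continuous_deriv hF)

theorem C1Lift.mean_value {F : CircleDeg1Liftˣ} (hF : F ∈ C1Lift) (x y : ℝ) :
    ∃ ξ, |ξ - x| ≤ |y - x| ∧ F y - F x = deriv F ξ * (y - x) := by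
  rcases lt_trichotomy x y with h | rfl | h
  · obtain ⟨c, hc, h2⟩ := exists_deriv_eq_slope F h (units_continuous F).continuousOn
      (C1Lift.differentiable hF).differentiableOn
    refine ⟨c, ?_, ?_⟩
    · rw [abs_of_pos (sub_pos.2 hc.1), abs_of_pos (sub_pos.2 h)]
      linarith [hc.2]
    · rw [h2, div_mul_cancel₀ _ (sub_pos.2 h).ne']
  · exact ⟨x, by simp, by simp⟩
  · obtain ⟨c, hc, h2⟩ := exists_deriv_eq_slope F h (units_continuous F).continuousOn
      (C1Lift.differentiable hF).differentiableOn
    refine ⟨c, ?_, ?_⟩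
    · rw [abs_of_neg (sub_neg.2 hc.2), abs_of_neg (sub_neg.2 h)]
      linarith [hc.1]
    · have := (sub_pos.2 h).ne'
      rw [h2]; field_simp; ring

/-! ### The covering relation -/

/-- The map `F` of the line is a lift of the permutation `f` of the circle. -/
def IsCircleLift (F : CircleDeg1Liftˣ) (f : Equiv.Perm UnitAddCircle) : Prop :=
  ∀ x : ℝ, f (x : UnitAddCircle) = (F x : UnitAddCircle)

theorem coe_eq_coe_iff_exists_int {x y : ℝ} :
    (x : UnitAddCircle) = (y : UnitAddCircle) ↔ ∃ k : ℤ, y = k + x := by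
  rw [eq_comm, ← sub_eq_zero, ← AddCircle.coe_sub, AddCircle.coe_eq_zero_iff]
  simp only [zsmul_eq_mul, mul_one]
  exact exists_congr fun k => ⟨fun h => by linarith, fun h => by linarith⟩

namespace IsCircleLift

variable {F K : CircleDeg1Liftˣ} {f g : Equiv.Perm UnitAddCircle}

theorem mul (hF : IsCircleLift F f) (hK : IsCircleLift K g) : IsCircleLift (F * K) (f * g) :=
  fun x => by rw [Equiv.Perm.mul_apply, hK, hF]; rfl

theorem inv (hF : IsCircleLift F f) : IsCircleLift F⁻¹ f⁻¹ := fun x => by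
  rw [Equiv.Perm.inv_eq_iff_eq, hF]; simp

theorem one : IsCircleLift 1 1 := fun _ => rfl

theorem pow (hF : IsCircleLift F f) (n : ℕ) : IsCircleLift (F ^ n) (f ^ n) := by
  induction n with
  | zero => exact one
  | succ n ih => rw [pow_succ, pow_succ]; exact ih.mul hF

theorem intTranslate_mul (hF : IsCircleLift F f) (k : ℤ) :
    IsCircleLift (intTranslate k * F) f := fun x => by
  rw [hF, coe_eq_coe_iff_exists_int]
  exact ⟨k, by simp⟩

/-- The difference of two lifts is continuous and integer-valued, hence constant. -/
theorem exists_eq_intTranslate_mul (hF : IsCircleLift F f) (hK : IsCircleLift K f) :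
    ∃ k : ℤ, K = intTranslate k * F := by
  have h : ∀ x, ∃ k : ℤ, K x - F x = k := fun x => by
    obtain ⟨k, hk⟩ := coe_eq_coe_iff_exists_int.1 ((hF x).symm.trans (hK x))
    exact ⟨k, by linarith⟩
  choose k hk using h
  have hc : Continuous fun x => K x - F x := (units_continuous K).sub (units_continuous F)
  have hkc : Continuous k := by
    rw [Int.isClosedEmbedding_coe_real.isEmbedding.continuous_iff]
    exact hc.congr hk
  obtain ⟨m, hm⟩ : ∃ m, ∀ x, k x = m :=
    ⟨k 0, fun x => PreconnectedSpace.constant inferInstance hkc⟩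
  exact ⟨m, units_ext fun x => by
    have := hk x
    rw [hm] at this
    rw [units_mul_apply, intTranslate_apply]; linarith⟩

theorem eq_of_translationNumber_eq (hF : IsCircleLift F f) (hK : IsCircleLift K f)
    (h : translationNumber (F : CircleDeg1Lift) = translationNumber (K : CircleDeg1Lift)) :
    F = K := by
  obtain ⟨k, rfl⟩ := hF.exists_eq_intTranslate_mul hK
  rw [translationNumber_intTranslate_mul] at h
  have hk : k = 0 := by exact_mod_cast (by linarith : (k : ℝ) = 0)
  subst hk
  exact units_ext fun x => by simp

/-- `F * K` and `K * F` lift the same map and are conjugate, so they share a translation number;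
that number singles out a lift. -/
theorem commute (hF : IsCircleLift F f) (hK : IsCircleLift K g) (h : Commute f g) :
    Commute F K := by
  refine eq_of_translationNumber_eq (hF.mul hK) (h.eq ▸ hK.mul hF) ?_
  have := translationNumber_conj_eq K ((F * K : CircleDeg1Liftˣ) : CircleDeg1Lift)
  rw [← this]
  congr 1
  rw [← Units.val_mul, ← Units.val_mul]
  congr 1
  group

end IsCircleLift

theorem exists_isCircleLift {f : Equiv.Perm UnitAddCircle} (hf : f ∈ DiffOnePlusCircle) :
    ∃ F ∈ C1Lift, IsCircleLift F f := by
  obtain ⟨⟨F, hF1, hF2, hF3, hF4⟩, ⟨K, hK1, hK2, hK3, hK4⟩⟩ := hf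
  let F' : CircleDeg1Lift := ⟨⟨F, hF2.monotone⟩, hF3⟩
  let K' : CircleDeg1Lift := ⟨⟨K, hK2.monotone⟩, hK3⟩
  have hc : Continuous F' := hF1.continuous
  have hb : Function.Bijective F' := ⟨hF2.injective, F'.continuous_iff_surjective.1 hc⟩
  obtain ⟨U, hU⟩ := isUnit_iff_bijective.2 hb
  have hc' : Continuous K' := hK1.continuous
  have hb' : Function.Bijective K' := ⟨hK2.injective, K'.continuous_iff_surjective.1 hc'⟩
  obtain ⟨W, hW⟩ := isUnit_iff_bijective.2 hb'
  have hUf : IsCircleLift U f := fun x => by rw [hU]; exact hF4 x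
  have hWf : IsCircleLift W f⁻¹ := fun x => by rw [hW]; exact hK4 x
  have hWc : ContDiff ℝ 1 W := by rw [hW]; exact hK1
  refine ⟨U, ⟨by rw [hU]; exact hF1, ?_⟩, hUf⟩
  -- `W` need not be the inverse of `U`, but both `W` and `U⁻¹` lift `f⁻¹`; they differ by an
  -- integer translation, so `U⁻¹` is of class `C^1`.
  obtain ⟨k, hk⟩ := hWf.exists_eq_intTranslate_mul hUf.inv
  rw [hk, Units.val_mul, coe_mul]
  exact (intTranslate_mem_C1Lift k).1.comp hWc

/-! ### Diffeomorphisms without periodic points do not contract exponentially along an orbit -/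

/-- Beyond some `M` the sequence stays below `s N`, so a maximum over a finite window starting at
`N` is a maximum over all later times. -/
theorem exists_later_maximum {s : ℕ → ℝ} (hpos : ∀ n, 0 < s n) (hs : Tendsto s atTop (𝓝 0))
    (N : ℕ) : ∃ k, N ≤ k ∧ ∀ j, k ≤ j → s j ≤ s k := by
  obtain ⟨M, hM⟩ := eventually_atTop.1 (hs.eventually (gt_mem_nhds (hpos N)))
  obtain ⟨k, hk, hmax⟩ := Finset.exists_max_image (Finset.Icc N (max N M)) s
    ⟨N, by simp⟩
  refine ⟨k, (Finset.mem_Icc.1 hk).1, fun j hj => ?_⟩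
  by_cases h : j ≤ max N M
  · exact hmax j (Finset.mem_Icc.2 ⟨(Finset.mem_Icc.1 hk).1.trans hj, h⟩)
  · have h1 : M ≤ j := (le_max_right _ _).trans (not_le.1 h).le
    exact (hM j h1).le.trans (hmax N (by simp))

theorem C1Lift.deriv_pow_add {F : CircleDeg1Liftˣ} (hF : F ∈ C1Lift) (i k : ℕ) (x : ℝ) :
    deriv (F ^ (i + k) : CircleDeg1Liftˣ) x =
      deriv (F ^ i : CircleDeg1Liftˣ) ((F ^ k) x) * deriv (F ^ k : CircleDeg1Liftˣ) x := by
  rw [pow_add, C1Lift.deriv_mul (C1Lift.pow_mem hF i) (C1Lift.pow_mem hF k)]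

/-- Along an orbit contracted at a definite rate, balls of definite size are contracted. -/
theorem C1Lift.deriv_pow_le_of_near {F : CircleDeg1Liftˣ} (hF : F ∈ C1Lift) {κ δ y : ℝ}
    (hκ : 1 < κ)
    (hdist : ∀ u v, |u - v| ≤ δ → deriv F u ≤ κ * deriv F v)
    (hy : ∀ i : ℕ, κ ^ (2 * i) * deriv (F ^ i : CircleDeg1Liftˣ) y ≤ 1) (i : ℕ) :
    ∀ z, |z - y| ≤ δ →
      deriv (F ^ i : CircleDeg1Liftˣ) z ≤ κ ^ i * deriv (F ^ i : CircleDeg1Liftˣ) y ∧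
      κ ^ i * |(F ^ i) z - (F ^ i) y| ≤ |z - y| := by
  have hκ0 : 0 < κ := by linarith
  -- The two conclusions feed each other: contraction up to time `i` keeps the orbits `δ`-close, so
  -- the next step of distortion costs one factor `κ`. Of the weight `κ ^ (2 * i)`, half pays for
  -- distortion and half remains as contraction.
  have key : ∀ i : ℕ, (∀ z, |z - y| ≤ δ →
      deriv (F ^ i : CircleDeg1Liftˣ) z ≤ κ ^ i * deriv (F ^ i : CircleDeg1Liftˣ) y) →
      ∀ z, |z - y| ≤ δ → κ ^ i * |(F ^ i) z - (F ^ i) y| ≤ |z - y| := by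
    intro i ih z hz
    obtain ⟨ξ, hξ, he⟩ := C1Lift.mean_value (C1Lift.pow_mem hF i) y z
    rw [he, abs_mul, abs_of_pos (C1Lift.deriv_pos (C1Lift.pow_mem hF i) ξ), ← mul_assoc]
    refine mul_le_of_le_one_left (abs_nonneg _) ?_
    calc κ ^ i * deriv (F ^ i : CircleDeg1Liftˣ) ξ
        ≤ κ ^ i * (κ ^ i * deriv (F ^ i : CircleDeg1Liftˣ) y) := by
          gcongr; exact ih ξ (hξ.trans hz)
      _ = κ ^ (2 * i) * deriv (F ^ i : CircleDeg1Liftˣ) y := by ring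
      _ ≤ 1 := hy i
  have main : ∀ i : ℕ, ∀ z, |z - y| ≤ δ →
      deriv (F ^ i : CircleDeg1Liftˣ) z ≤ κ ^ i * deriv (F ^ i : CircleDeg1Liftˣ) y := by
    intro i
    induction i with
    | zero => intro z _; simp only [pow_zero, one_mul, deriv_units_one]; rfl
    | succ i ih =>
      intro z hz
      have h1 := key i ih z hz
      have h2 : |(F ^ i) z - (F ^ i) y| ≤ δ :=
        (le_mul_of_one_le_left (abs_nonneg _) (one_le_pow₀ hκ.le)).trans (h1.trans hz)
      rw [add_comm i 1, C1Lift.deriv_pow_add hF, C1Lift.deriv_pow_add hF, pow_one]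
      calc _ ≤ (κ * deriv F ((F ^ i) y)) * (κ ^ i * deriv (F ^ i : CircleDeg1Liftˣ) y) := by
            gcongr
            · exact (C1Lift.deriv_pos (C1Lift.pow_mem hF i) z).le
            · exact mul_nonneg hκ0.le (C1Lift.deriv_pos hF _).le
            · exact hdist _ _ h2
            · exact ih z hz
        _ = _ := by ring
  exact fun z hz => ⟨main i z hz, key i (main i) z hz⟩

/-- Uniform continuity of the derivative gives an additive error; the positive lower bound makes it
multiplicative. -/
theorem C1Lift.exists_distortion {F : CircleDeg1Liftˣ} (hF : F ∈ C1Lift) {κ : ℝ} (hκ : 1 < κ) :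
    ∃ δ, 0 < δ ∧ ∀ u v, |u - v| ≤ δ → deriv F u ≤ κ * deriv F v := by
  obtain ⟨c, hc0, hc⟩ := C1Lift.deriv_bounded_below hF
  have hu := Metric.uniformContinuous_iff.1 (C1Lift.uniformContinuous_deriv hF)
    ((κ - 1) * c) (mul_pos (by linarith) hc0)
  obtain ⟨δ, hδ, h⟩ := hu
  refine ⟨δ / 2, by positivity, fun u v huv => ?_⟩
  have h1 := h (a := u) (b := v) (by rw [Real.dist_eq]; linarith)
  rw [Real.dist_eq, abs_lt] at h1
  nlinarith [hc v]

/-- At a time where the weighted derivative `s` dominates all its later values, every future iterate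
contracts a ball of fixed radius `δ`. A near return between two such times maps the ball into itself
up to an integer translation. -/
theorem C1Lift.exists_periodic_of_contraction {F : CircleDeg1Liftˣ} (hF : F ∈ C1Lift)
    {x C θ : ℝ} (hθ : 1 < θ)
    (hx : ∀ k : ℕ, θ ^ k * deriv (F ^ k : CircleDeg1Liftˣ) x ≤ C) :
    ∃ n : ℕ, 0 < n ∧ ∃ k : ℤ, ∃ y, (F ^ n) y = k + y := by
  obtain ⟨κ, hκ1, hκθ⟩ : ∃ κ : ℝ, 1 < κ ∧ κ ^ 2 < θ := by
    refine ⟨√((1 + θ) / 2), ?_, ?_⟩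
    · rw [Real.lt_sqrt] <;> linarith
    · rw [Real.sq_sqrt] <;> linarith
  have hκ0 : 0 < κ := by linarith
  obtain ⟨δ, hδ, hdist⟩ := C1Lift.exists_distortion hF hκ1
  set s : ℕ → ℝ := fun k => κ ^ (2 * k) * deriv (F ^ k : CircleDeg1Liftˣ) x with hs
  have hspos : ∀ k, 0 < s k := fun k =>
    mul_pos (by positivity) (C1Lift.deriv_pos (C1Lift.pow_mem hF k) x)
  have hst : Tendsto s atTop (𝓝 0) := by
    have h0 : Tendsto (fun k : ℕ => C * (κ ^ 2 / θ) ^ k) atTop (𝓝 0) := by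
      rw [← mul_zero C]
      exact (tendsto_pow_atTop_nhds_zero_of_lt_one (by positivity)
        ((div_lt_one (by linarith)).2 hκθ)).const_mul C
    refine squeeze_zero (fun k => (hspos k).le) (fun k => ?_) h0
    have hθk : 0 < θ ^ k := by positivity
    have := hx k
    simp only [hs, div_pow, ← pow_mul]
    rw [mul_div_assoc', le_div_iff₀ hθk]
    calc _ = κ ^ (2 * k) * (θ ^ k * deriv (F ^ k : CircleDeg1Liftˣ) x) := by ring
      _ ≤ κ ^ (2 * k) * C := by gcongr
      _ = _ := by ring
  obtain ⟨R, hR⟩ : ∃ R : ℕ, 2 ≤ κ ^ R := by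
    obtain ⟨R, hR⟩ := pow_unbounded_of_one_lt 2 hκ1
    exact ⟨R, hR.le⟩
  choose r hr hrmax using exists_later_maximum hspos hst
  -- a sequence of times of maximality with large gaps
  let t : ℕ → ℕ := fun n => Nat.rec (r 0) (fun _ p => r (p + R + 1)) n
  have htmax : ∀ n j, t n ≤ j → s j ≤ s (t n) := by
    intro n
    cases n with
    | zero => exact hrmax _
    | succ n => exact hrmax _
  have htstep : ∀ n, t n + (R + 1) ≤ t (n + 1) := fun n => hr (t n + R + 1)
  have htmono : StrictMono t := strictMono_nat_of_lt_succ fun n => by have := htstep n; omega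
  -- By compactness two selected times agree within `δ / 2` modulo `1`; their gap exceeds `R`, so
  -- the iterate between them at least halves distances in the ball.
  obtain ⟨a, -, φ, hφ, hlim⟩ := (isCompact_Icc (a := (0 : ℝ)) (b := 1)).tendsto_subseq
    (x := fun n => Int.fract ((F ^ t n) x))
    (fun n => ⟨Int.fract_nonneg _, (Int.fract_lt_one _).le⟩)
  obtain ⟨N, hN⟩ := Metric.cauchySeq_iff.1 hlim.cauchySeq (δ / 2) (by positivity)
  have hclose := hN (N + 1) (by omega) N le_rfl
  rw [Real.dist_eq] at hclose
  simp only [Function.comp] at hclose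
  set k₁ := t (φ N) with hk₁
  set k₂ := t (φ (N + 1)) with hk₂
  have hk : k₁ + (R + 1) ≤ k₂ :=
    (htstep _).trans (htmono.monotone (hφ (Nat.lt_succ_self N)))
  obtain ⟨m, hm⟩ := Nat.exists_eq_add_of_le (show k₁ ≤ k₂ by omega)
  set y := (F ^ k₁) x with hy
  have hym : (F ^ k₂) x = (F ^ m) y := by
    rw [hm, add_comm, pow_add]; rfl
  have hyc : ∀ i : ℕ, κ ^ (2 * i) * deriv (F ^ i : CircleDeg1Liftˣ) y ≤ 1 := by
    intro i
    have h1 := htmax (φ N) (i + k₁) (by omega)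
    rw [← hk₁] at h1
    simp only [hs] at h1
    rw [C1Lift.deriv_pow_add hF, ← hy] at h1
    have h2 := hspos k₁
    simp only [hs] at h2
    rw [← mul_le_mul_iff_left₀ h2]
    calc _ = κ ^ (2 * (i + k₁)) * (deriv (F ^ i : CircleDeg1Liftˣ) y *
            deriv (F ^ k₁ : CircleDeg1Liftˣ) x) := by ring
      _ ≤ _ := by rw [one_mul]; exact h1
  have hcontr := C1Lift.deriv_pow_le_of_near hF hκ1 hdist hyc m
  set j : ℤ := ⌊(F ^ k₂) x⌋ - ⌊y⌋ with hj
  have hκm : 2 ≤ κ ^ m := hR.trans (pow_le_pow_right₀ hκ1.le (by omega))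
  have hyj : |(F ^ m) y - j - y| ≤ δ / 2 := by
    rw [← hym]
    have e : (F ^ k₂) x - j - y = Int.fract ((F ^ k₂) x) - Int.fract y := by
      simp only [Int.fract, hj]; push_cast; ring
    rw [e]; exact hclose.le
  have hmaps : Set.MapsTo (fun z => (F ^ m) z - (j : ℝ)) (Set.Icc (y - δ) (y + δ))
      (Set.Icc (y - δ) (y + δ)) := by
    intro z hz
    have hz' : |z - y| ≤ δ := abs_le.2 ⟨by linarith [hz.1], by linarith [hz.2]⟩
    have h1 := (hcontr z hz').2
    have h2 : |(F ^ m) z - (F ^ m) y| ≤ δ / 2 := by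
      nlinarith [abs_nonneg ((F ^ m) z - (F ^ m) y)]
    rw [abs_le] at h2 hyj
    exact ⟨by linarith, by linarith⟩
  obtain ⟨z, -, hz⟩ := exists_mem_Icc_isFixedPt_of_mapsTo
    (((units_continuous (F ^ m)).sub continuous_const).continuousOn) (by linarith) hmaps
  refine ⟨m, by omega, j, z, ?_⟩
  have : (F ^ m) z - (j : ℝ) = z := hz
  linarith

/-! ### Hyperbolic linear maps -/

theorem tendsto_zero_of_le_mul_add {u b : ℕ → ℝ} {r : ℝ} (hr0 : 0 ≤ r) (hr : r < 1)
    (hu : ∀ n, 0 ≤ u n) (hb : Tendsto b atTop (𝓝 0)) (h : ∀ n, u (n + 1) ≤ r * u n + b n) :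
    Tendsto u atTop (𝓝 0) := by
  rw [Metric.tendsto_atTop]
  intro ε hε
  have hpos : 0 < ε / 2 * (1 - r) := by
    have : 0 < 1 - r := by linarith
    positivity
  obtain ⟨N, hN⟩ := eventually_atTop.1 (hb.eventually (gt_mem_nhds hpos))
  -- `ε / 2` is the fixed point of `t ↦ r * t + ε / 2 * (1 - r)`.
  have hk : ∀ k, u (N + k) ≤ r ^ k * u N + ε / 2 := by
    intro k
    induction k with
    | zero => simp; linarith
    | succ k ih =>
      have h1 := h (N + k)
      have h2 := hN (N + k) (by omega)
      have h3 := mul_le_mul_of_nonneg_left ih hr0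
      rw [pow_succ, ← add_assoc]
      nlinarith
  have hlim : Tendsto (fun k => r ^ k * u N) atTop (𝓝 0) := by
    simpa using (tendsto_pow_atTop_nhds_zero_of_lt_one hr0 hr).mul_const (u N)
  obtain ⟨M, hM⟩ := eventually_atTop.1 (hlim.eventually (gt_mem_nhds (half_pos hε)))
  refine ⟨N + M, fun n hn => ?_⟩
  obtain ⟨k, rfl⟩ := Nat.exists_eq_add_of_le (show N ≤ n by omega)
  have := hk k
  have := hM k (by omega)
  rw [Real.dist_eq, sub_zero, abs_of_nonneg (hu _)]
  linarith

section Hyperbolic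

variable {E : Type*} [NormedAddCommGroup E] [NormedSpace ℂ E]

theorem tendsto_zero_of_eq_smul_add {x y : ℕ → E} {c : ℂ} (hc : ‖c‖ < 1)
    (hy : Tendsto y atTop (𝓝 0)) (h : ∀ n, x (n + 1) = c • x n + y n) :
    Tendsto x atTop (𝓝 0) := by
  rw [tendsto_zero_iff_norm_tendsto_zero] at hy ⊢
  refine tendsto_zero_of_le_mul_add (norm_nonneg c) hc (fun n => norm_nonneg _) hy fun n => ?_
  rw [h n, ← norm_smul]
  exact norm_add_le _ _

/-- The vectors whose iterates under `B` tend to zero. -/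
def stableSubmodule (B : E →L[ℂ] E) : Submodule ℂ E where
  carrier := {w | Tendsto (fun n : ℕ => (B ^ n) w) atTop (𝓝 0)}
  add_mem' {v w} hv hw := by
    simpa using Tendsto.add hv hw
  zero_mem' := by simp
  smul_mem' c w hw := by
    have := Tendsto.const_smul hw c
    rw [smul_zero] at this
    exact this.congr fun n => (map_smul (B ^ n) c w).symm

theorem mem_stableSubmodule {B : E →L[ℂ] E} {w : E} :
    w ∈ stableSubmodule B ↔ Tendsto (fun n : ℕ => (B ^ n) w) atTop (𝓝 0) := Iff.rfl

variable (B : (E →L[ℂ] E)ˣ)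

/-- The linear endomorphism underlying an invertible operator. -/
abbrev unitsEnd : Module.End ℂ E := ((B : E →L[ℂ] E) : E →ₗ[ℂ] E)

theorem inv_apply_apply (w : E) :
    ((B⁻¹ : (E →L[ℂ] E)ˣ) : E →L[ℂ] E) ((B : E →L[ℂ] E) w) = w :=
  DFunLike.congr_fun (Units.inv_mul B) w

theorem unitsEnd_sub_apply (μ : ℂ) (w : E) :
    (unitsEnd B - μ • (1 : Module.End ℂ E)) w = (B : E →L[ℂ] E) w - μ • w := rfl

/-- Put `v = (B - μ) w`, stable by induction on the nilpotency exponent. Then `B^(n+1) w = μ B^n w +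
B^n v` is a contracting recursion with a perturbation tending to zero. -/
theorem genEigenspace_le_stable {μ : ℂ} (hμ : ‖μ‖ < 1) :
    (unitsEnd B).maxGenEigenspace μ ≤ stableSubmodule (B : E →L[ℂ] E) := by
  intro w hw
  obtain ⟨k, hk⟩ := Module.End.mem_maxGenEigenspace _ _ _ |>.1 hw
  clear hw
  induction k generalizing w with
  | zero =>
    have : w = 0 := by simpa using hk
    rw [this]; exact Submodule.zero_mem _
  | succ k ih =>
    rw [pow_succ, Module.End.mul_apply] at hk
    have h1 := ih hk
    refine tendsto_zero_of_eq_smul_add hμ h1 fun n => ?_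
    rw [unitsEnd_sub_apply, map_sub, map_smul, pow_succ, mul_apply_eq_comp]
    abel

/-- Inverting `B w = μ w + v` gives `B⁻¹ w = μ⁻¹ w - μ⁻¹ B⁻¹ v`, a recursion with factor `μ⁻¹` of
norm below one. -/
theorem genEigenspace_le_unstable {μ : ℂ} (hμ : 1 < ‖μ‖) :
    (unitsEnd B).maxGenEigenspace μ ≤
      stableSubmodule ((B⁻¹ : (E →L[ℂ] E)ˣ) : E →L[ℂ] E) := by
  intro w hw
  obtain ⟨k, hk⟩ := Module.End.mem_maxGenEigenspace _ _ _ |>.1 hw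
  clear hw
  have hμ0 : μ ≠ 0 := by rintro rfl; simp at hμ; linarith
  induction k generalizing w with
  | zero =>
    have : w = 0 := by simpa using hk
    rw [this]; exact Submodule.zero_mem _
  | succ k ih =>
    rw [pow_succ, Module.End.mul_apply] at hk
    have h1 := ih hk
    have h2 : Tendsto (fun n : ℕ => -μ⁻¹ • (((B⁻¹ : (E →L[ℂ] E)ˣ) : E →L[ℂ] E) ^ (n + 1))
        ((unitsEnd B - μ • (1 : Module.End ℂ E)) w)) atTop (𝓝 0) := by
      simpa only [smul_zero] using
        ((tendsto_add_atTop_iff_nat 1).2 (mem_stableSubmodule.1 h1)).const_smul (-μ⁻¹)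
    refine tendsto_zero_of_eq_smul_add (c := μ⁻¹) ?_ h2 fun n => ?_
    · rw [norm_inv]; exact inv_lt_one_of_one_lt₀ hμ
    · rw [unitsEnd_sub_apply, map_sub, map_smul]
      have e : (((B⁻¹ : (E →L[ℂ] E)ˣ) : E →L[ℂ] E) ^ (n + 1)) ((B : E →L[ℂ] E) w) =
          (((B⁻¹ : (E →L[ℂ] E)ˣ) : E →L[ℂ] E) ^ n) w := by
        rw [pow_succ, mul_apply_eq_comp, inv_apply_apply]
      rw [e, smul_sub, smul_smul, neg_mul, inv_mul_cancel₀ hμ0]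
      simp

/-- An invertible operator without eigenvalues of norm one admits a projection commuting with it
which separates the stable from the unstable vectors. -/
theorem exists_hyperbolic_projection [FiniteDimensional ℂ E]
    (hB : ∀ μ, (unitsEnd B).HasEigenvalue μ → ‖μ‖ ≠ 1) :
    ∃ P : E →ₗ[ℂ] E, (∀ w, P ((B : E →L[ℂ] E) w) = (B : E →L[ℂ] E) (P w)) ∧
      (∀ w, P w ∈ stableSubmodule (B : E →L[ℂ] E)) ∧
      ∀ w, w - P w ∈ stableSubmodule ((B⁻¹ : (E →L[ℂ] E)ˣ) : E →L[ℂ] E) := by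
  set f := unitsEnd B
  let I : Set ℂ := {μ | ‖μ‖ < 1}
  let S : Submodule ℂ E := ⨆ μ ∈ I, f.maxGenEigenspace μ
  let U : Submodule ℂ E := ⨆ μ ∈ Iᶜ, f.maxGenEigenspace μ
  have hinv : ∀ J : Set ℂ, ∀ w ∈ (⨆ μ ∈ J, f.maxGenEigenspace μ : Submodule ℂ E),
      f w ∈ (⨆ μ ∈ J, f.maxGenEigenspace μ : Submodule ℂ E) := by
    intro J
    suffices h : (⨆ μ ∈ J, f.maxGenEigenspace μ) ≤
        (⨆ μ ∈ J, f.maxGenEigenspace μ : Submodule ℂ E).comap f from fun w hw => h hw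
    refine iSup₂_le fun μ hμ w hw => ?_
    exact Submodule.mem_iSup_of_mem μ (Submodule.mem_iSup_of_mem hμ
      (Module.End.mapsTo_maxGenEigenspace_of_comm (Commute.refl f) μ hw))
  have hS : S ≤ stableSubmodule (B : E →L[ℂ] E) :=
    iSup₂_le fun μ hμ => genEigenspace_le_stable B hμ
  have hU : U ≤ stableSubmodule ((B⁻¹ : (E →L[ℂ] E)ˣ) : E →L[ℂ] E) := by
    refine iSup₂_le fun μ hμ => ?_
    -- On the unit circle there is no eigenvalue, so the generalised eigenspace is zero.
    rcases (not_lt.1 hμ : 1 ≤ ‖μ‖).eq_or_lt with h | h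
    · have h1 : ¬ f.HasEigenvalue μ := fun h2 => hB μ h2 h.symm
      have h2 : f.maxGenEigenspace μ = ⊥ := by
        by_contra hne
        exact h1 (Module.End.HasUnifEigenvalue.lt one_pos hne)
      rw [h2]; exact bot_le
    · exact genEigenspace_le_unstable B h
  have hcompl : IsCompl S U := by
    refine ⟨f.independent_maxGenEigenspace.disjoint_biSup_biSup disjoint_compl_right, ?_⟩
    rw [codisjoint_iff, eq_top_iff, ← f.iSup_maxGenEigenspace_eq_top]
    refine iSup_le fun μ => ?_
    by_cases h : μ ∈ I
    · exact (le_iSup₂_of_le (f := fun μ (_ : μ ∈ I) => f.maxGenEigenspace μ) μ h le_rfl).trans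
        le_sup_left
    · exact (le_iSup₂_of_le (f := fun μ (_ : μ ∈ Iᶜ) => f.maxGenEigenspace μ) μ h le_rfl).trans
        le_sup_right
  have hsub : ∀ w, w - S.projection U hcompl w ∈ U := fun w => by
    rw [← Submodule.projection_apply_eq_zero_iff hcompl, map_sub,
      Submodule.projection_apply_of_mem_left hcompl (Submodule.projection_apply_mem hcompl w),
      sub_self]
  refine ⟨S.projection U hcompl, fun w => ?_,
    fun w => hS (Submodule.projection_apply_mem hcompl w), fun w => hU (hsub w)⟩
  have h1 : f w = f (S.projection U hcompl w) + f (w - S.projection U hcompl w) := by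
    rw [← map_add]; simp
  change S.projection U hcompl (f w) = f (S.projection U hcompl w)
  rw [h1, map_add,
    Submodule.projection_apply_of_mem_left hcompl
      (hinv I _ (Submodule.projection_apply_mem hcompl w)),
    (Submodule.projection_apply_eq_zero_iff hcompl).2 (hinv Iᶜ _ (hsub w)), add_zero]

end Hyperbolic

/-- In finite dimension, convergence on a basis controls the whole operator. -/
theorem exists_uniform_of_pointwise {E : Type*} [NormedAddCommGroup E] [NormedSpace ℂ E]
    [FiniteDimensional ℂ E] {X : ℕ → E →ₗ[ℂ] E}
    (hX : ∀ w, Tendsto (fun n => X n w) atTop (𝓝 0)) {ε : ℝ} (hε : 0 < ε) :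
    ∀ᶠ n in atTop, ∀ w, ‖X n w‖ ≤ ε * ‖w‖ := by
  let b := Module.finBasis ℂ E
  set M := ‖b.equivFunL.toContinuousLinearMap‖ + 1 with hM
  have hM0 : 0 < M := by positivity
  have hb : ∀ w j, ‖b.repr w j‖ ≤ M * ‖w‖ := fun w j => by
    have h1 : ‖b.equivFunL w j‖ ≤ ‖b.equivFunL w‖ := norm_le_pi_norm (b.equivFunL w) j
    have h2 : ‖b.equivFunL w‖ ≤ ‖b.equivFunL.toContinuousLinearMap‖ * ‖w‖ :=
      b.equivFunL.toContinuousLinearMap.le_opNorm w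
    have h3 := norm_nonneg w
    have h4 : b.repr w j = b.equivFunL w j := rfl
    rw [h4]
    linarith
  have h : Tendsto (fun n => ∑ j, ‖X n (b j)‖) atTop (𝓝 0) := by
    have : Tendsto (fun n => ∑ j, ‖X n (b j)‖) atTop (𝓝 (∑ _j, (0 : ℝ))) :=
      tendsto_finsetSum _ fun j _ => (hX (b j)).norm.trans_eq (by simp)
    simpa using this
  filter_upwards [h.eventually (gt_mem_nhds (div_pos hε hM0))] with n hn w
  have hw := b.sum_repr w
  calc ‖X n w‖ = ‖∑ j, b.repr w j • X n (b j)‖ := by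
        conv_lhs => rw [← hw, map_sum]
        simp
    _ ≤ ∑ j, ‖b.repr w j • X n (b j)‖ := norm_sum_le _ _
    _ ≤ ∑ j, M * ‖w‖ * ‖X n (b j)‖ := Finset.sum_le_sum fun j _ => by
        rw [norm_smul]; gcongr; exact hb w j
    _ ≤ M * ‖w‖ * (ε / M) := by
        rw [← Finset.mul_sum]
        gcongr
    _ = ε * ‖w‖ := by field_simp

/-- `hS` at `g ^ T w` bounds `P w` by a quarter of `‖g ^ T w‖`, and `hU` at `f ^ T w` bounds `w - P
w` by a quarter of `‖f ^ T w‖`. -/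
theorem norm_le_of_hyperbolic_projection {E : Type*} [NormedAddCommGroup E] [NormedSpace ℂ E]
    {f g : E →L[ℂ] E} {P : E →ₗ[ℂ] E}
    (hfg1 : f * g = 1) (hgf1 : g * f = 1) (hcomm : ∀ w, P (f w) = f (P w)) {T : ℕ}
    (hS : ∀ w, ‖(f ^ T) (P w)‖ ≤ 1 / 4 * ‖w‖) (hU : ∀ w, ‖(g ^ T) (w - P w)‖ ≤ 1 / 4 * ‖w‖)
    (w : E) : 4 * ‖w‖ ≤ ‖(f ^ T) w‖ + ‖(g ^ T) w‖ := by
  have hc : Commute f g := hfg1.trans hgf1.symm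
  have hfg : ∀ n w, (f ^ n) ((g ^ n) w) = w := fun n w => by
    have : f ^ n * g ^ n = 1 := by rw [← hc.mul_pow, hfg1, one_pow]
    exact DFunLike.congr_fun this w
  have hgf : ∀ n w, (g ^ n) ((f ^ n) w) = w := fun n w => by
    have : g ^ n * f ^ n = 1 := by rw [← hc.symm.mul_pow, hgf1, one_pow]
    exact DFunLike.congr_fun this w
  have hPf : ∀ n w, P ((f ^ n) w) = (f ^ n) (P w) := fun n => by
    induction n with
    | zero => intro w; simp
    | succ n ih =>
      intro w
      rw [pow_succ, mul_apply_eq_comp, mul_apply_eq_comp, ih, hcomm]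
  have hPg : ∀ n w, P ((g ^ n) w) = (g ^ n) (P w) := fun n w => by
    rw [← hgf n (P ((g ^ n) w)), ← hPf, hfg]
  have e1 := hS ((g ^ T) w)
  rw [hPg, hfg] at e1
  have e2 := hU ((f ^ T) w)
  rw [hPf, ← map_sub, hgf] at e2
  have e3 := norm_add_le (P w) (w - P w)
  rw [add_sub_cancel] at e3
  linarith

theorem exists_hyperbolic_time {E : Type*} [NormedAddCommGroup E]
    [NormedSpace ℂ E] [FiniteDimensional ℂ E] (B : (E →L[ℂ] E)ˣ)
    (hB : ∀ μ, (unitsEnd B).HasEigenvalue μ → ‖μ‖ ≠ 1) :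
    ∃ T : ℕ, 0 < T ∧ ∀ w : E, 4 * ‖w‖ ≤ ‖(B.val ^ T) w‖ + ‖(B⁻¹.val ^ T) w‖ := by
  obtain ⟨P, hcomm, hS, hU⟩ := exists_hyperbolic_projection B hB
  have h1 := exists_uniform_of_pointwise (X := fun n => (B.val ^ n).toLinearMap ∘ₗ P) hS
    (show (0 : ℝ) < 1 / 4 by norm_num)
  have h2 := exists_uniform_of_pointwise
    (X := fun n => (B⁻¹.val ^ n).toLinearMap ∘ₗ (LinearMap.id - P))
    (fun w => mem_stableSubmodule.1 (hU w))
    (show (0 : ℝ) < 1 / 4 by norm_num)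
  obtain ⟨T, hT, hT1, hT2⟩ := ((eventually_gt_atTop 0).and (h1.and h2)).exists
  exact ⟨T, hT, norm_le_of_hyperbolic_projection B.mul_inv B.inv_mul hcomm hT1 hT2⟩

/-! ### Pseudo-orbits of linear maps over a finite time. -/

section PseudoOrbit

variable {E : Type*} [NormedAddCommGroup E] [NormedSpace ℂ E]

/-- Expand `‖z'‖ ≤ ‖z' - C z‖ + ‖C‖ * ‖z‖`: `ε ≤ 1 / 2` absorbs the error term on the right, and the
other bound on `ε` controls the rest by `η`. -/
theorem exists_error_bound (C : E →L[ℂ] E) {η : ℝ} (hη : 0 < η) :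
    ∃ ε, 0 < ε ∧ ∀ z z' : E, ‖z' - C z‖ ≤ ε * (‖z‖ + ‖z'‖) → ‖z' - C z‖ ≤ η * ‖z‖ := by
  have hC : 0 < 1 + ‖C‖ := by positivity
  refine ⟨min (1 / 2) (η / (2 * (1 + ‖C‖))), by positivity, fun z z' h => ?_⟩
  set ε := min (1 / 2) (η / (2 * (1 + ‖C‖)))
  have h1 : ε ≤ 1 / 2 := min_le_left _ _
  have h0 : 0 < ε := by positivity
  have h2 : ε * (1 + ‖C‖) ≤ η / 2 := by
    have : ε ≤ η / (2 * (1 + ‖C‖)) := min_le_right _ _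
    rw [le_div_iff₀ (by positivity)] at this
    linarith
  have h3 : ‖z'‖ ≤ ‖z' - C z‖ + ‖C‖ * ‖z‖ := by
    have := norm_add_le (z' - C z) (C z)
    rw [sub_add_cancel] at this
    linarith [C.le_opNorm z]
  have h4 := mul_le_mul_of_nonneg_left h3 h0.le
  have h5 := mul_le_mul_of_nonneg_right h2 (norm_nonneg z)
  have h6 := mul_le_mul_of_nonneg_right h1 (norm_nonneg (z' - C z))
  nlinarith

/-- For fixed `j`, the accumulated error is the image under `C` of the previous one plus a new one,
each allotted `η / 2`. -/
theorem exists_pseudoOrbit_bound (C : E →L[ℂ] E) (j : ℕ) :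
    ∀ η : ℝ, 0 < η → ∃ ε, 0 < ε ∧ ∀ z : ℕ → E,
      (∀ i, ‖z (i + 1) - C (z i)‖ ≤ ε * (‖z i‖ + ‖z (i + 1)‖)) →
      ‖z j - (C ^ j) (z 0)‖ ≤ η * ‖z 0‖ := by
  induction j with
  | zero =>
    exact fun η hη => ⟨1, one_pos, fun z _ => by simp; positivity⟩
  | succ j ih =>
    intro η hη
    have hC := norm_nonneg C
    have hCj := norm_nonneg (C ^ j)
    obtain ⟨ε₁, h1, hz1⟩ := ih (min 1 (η / (2 * (‖C‖ + 1)))) (by positivity)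
    obtain ⟨ε₂, h2, hz2⟩ := exists_error_bound C
      (show 0 < η / (2 * (1 + ‖C ^ j‖)) by positivity)
    refine ⟨min ε₁ ε₂, lt_min h1 h2, fun z hz => ?_⟩
    have a1 := hz1 z fun i => (hz i).trans (by gcongr; exact min_le_left _ _)
    have a2 := hz2 (z j) (z (j + 1)) ((hz j).trans (by gcongr; exact min_le_right _ _))
    have a3 : ‖z j‖ ≤ (1 + ‖C ^ j‖) * ‖z 0‖ := by
      have b1 := norm_add_le (z j - (C ^ j) (z 0)) ((C ^ j) (z 0))
      rw [sub_add_cancel] at b1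
      have b2 := (C ^ j).le_opNorm (z 0)
      have b3 : min 1 (η / (2 * (‖C‖ + 1))) * ‖z 0‖ ≤ 1 * ‖z 0‖ := by
        gcongr; exact min_le_left _ _
      linarith
    have a4 : ‖C (z j - (C ^ j) (z 0))‖ ≤ η / 2 * ‖z 0‖ := by
      refine (C.le_opNorm _).trans ?_
      have b1 : ‖z j - (C ^ j) (z 0)‖ ≤ η / (2 * (‖C‖ + 1)) * ‖z 0‖ :=
        a1.trans (by gcongr; exact min_le_right _ _)
      calc ‖C‖ * ‖z j - (C ^ j) (z 0)‖
          ≤ (‖C‖ + 1) * (η / (2 * (‖C‖ + 1)) * ‖z 0‖) := by gcongr; linarith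
        _ = η / 2 * ‖z 0‖ := by field_simp
    have a5 : ‖z (j + 1) - C (z j)‖ ≤ η / 2 * ‖z 0‖ := by
      refine a2.trans ?_
      calc η / (2 * (1 + ‖C ^ j‖)) * ‖z j‖
          ≤ η / (2 * (1 + ‖C ^ j‖)) * ((1 + ‖C ^ j‖) * ‖z 0‖) := by gcongr
        _ = η / 2 * ‖z 0‖ := by field_simp
    have e : z (j + 1) - (C ^ (j + 1)) (z 0) =
        (z (j + 1) - C (z j)) + C (z j - (C ^ j) (z 0)) := by
      rw [pow_succ', mul_apply_eq_comp, map_sub]; abel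
    rw [e]
    linarith [norm_add_le (z (j + 1) - C (z j)) (C (z j - (C ^ j) (z 0)))]

end PseudoOrbit

/-- Discrete convexity forces growth in one of the two directions. -/
theorem growth_of_convex {b : ℤ → ℝ} (hb : ∀ k, 0 ≤ b k)
    (h : ∀ k, 3 / 2 * b k ≤ max (b (k + 1)) (b (k - 1))) (h0 : 3 / 2 * b 0 ≤ b 1) (k : ℕ) :
    (3 / 2) ^ k * b 0 ≤ b k := by
  have hstep : ∀ k : ℕ, 3 / 2 * b k ≤ b (k + 1) := by
    intro k
    induction k with
    | zero => simpa using h0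
    | succ k ih =>
      have h1 := h (k + 1)
      rw [add_sub_cancel_right] at h1
      have := hb k
      push_cast
      rcases le_max_iff.1 h1 with h2 | h2
      · exact h2
      -- Growth by `3 / 2` both from `k` to `k + 1` and back is possible only at zero.
      · have h3 : b (k + 1) = 0 := le_antisymm (by linarith) (hb _)
        rw [h3, mul_zero]
        exact hb _
  induction k with
  | zero => simp
  | succ k ih =>
    have := hstep k
    rw [pow_succ']
    push_cast
    linarith

/-- Over time `T` a true orbit satisfies the inequality with constant `4`. Errors of `1 / 2` on each
side leave `3`, so one of the two neighbours at distance `T` has norm at least `3 / 2` of the middle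
one. -/
theorem growth_of_pseudoOrbit {E : Type*} [NormedAddCommGroup E]
    [NormedSpace ℂ E] [FiniteDimensional ℂ E] (B : (E →L[ℂ] E)ˣ)
    (hB : ∀ μ, (unitsEnd B).HasEigenvalue μ → ‖μ‖ ≠ 1) :
    ∃ T : ℕ, 0 < T ∧ ∃ ε, 0 < ε ∧ ∀ w : ℤ → E,
      (∀ n, ‖B.val (w (n + 1)) - w n‖ ≤ ε * (‖w n‖ + ‖w (n + 1)‖)) →
      (∀ k : ℕ, (3 / 2) ^ k * ‖w 0‖ ≤ ‖w (k * T)‖) ∨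
      (∀ k : ℕ, (3 / 2) ^ k * ‖w 0‖ ≤ ‖w (-(k * T))‖) := by
  obtain ⟨T, hT, hyp⟩ := exists_hyperbolic_time B hB
  set f : E →L[ℂ] E := B.val with hf
  set g : E →L[ℂ] E := B⁻¹.val with hg
  obtain ⟨ε₁, h1, hz1⟩ := exists_pseudoOrbit_bound f T (1 / 2) (by norm_num)
  obtain ⟨ε₂, h2, hz2⟩ := exists_pseudoOrbit_bound g T (1 / 2) (by norm_num)
  refine ⟨T, hT, min ε₁ (ε₂ / (‖g‖ + 1)), by positivity, fun w hw => ?_⟩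
  have hmax : ∀ n, 3 / 2 * ‖w n‖ ≤ max ‖w (n + T)‖ ‖w (n - T)‖ := by
    intro n
    -- The hypothesis reads `w n ≈ f (w (n + 1))`: `f` moves towards smaller indices and `g` towards
    -- larger ones.
    have a1 := hz1 (fun i => w (n - i)) fun i => by
      have e := hw (n - (i + 1))
      rw [show n - ((i : ℤ) + 1) + 1 = n - i by ring] at e
      push_cast
      rw [norm_sub_rev, add_comm ‖w (n - i)‖]
      exact e.trans (by gcongr; exact min_le_left _ _)
    have a2 := hz2 (fun i => w (n + i)) fun i => by
      have e := hw (n + i)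
      push_cast
      rw [← add_assoc]
      have e2 : w (n + i + 1) - g (w (n + i)) = g (f (w (n + i + 1)) - w (n + i)) := by
        rw [map_sub, hg, hf, inv_apply_apply]
      rw [e2]
      refine (g.le_opNorm _).trans ?_
      calc ‖g‖ * ‖f (w (n + i + 1)) - w (n + i)‖
          ≤ (‖g‖ + 1) * (ε₂ / (‖g‖ + 1) * (‖w (n + i)‖ + ‖w (n + i + 1)‖)) := by
            gcongr
            · linarith
            · exact e.trans (by gcongr; exact min_le_right _ _)
        _ = _ := by field_simp
    simp only [Nat.cast_zero, sub_zero, add_zero] at a1 a2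
    have a3 := hyp (w n)
    have a4 := norm_le_norm_add_norm_sub (w (n - T)) ((f ^ T) (w n))
    have a5 := norm_le_norm_add_norm_sub (w (n + T)) ((g ^ T) (w n))
    have a6 := le_max_left ‖w (n + T)‖ ‖w (n - T)‖
    have a7 := le_max_right ‖w (n + T)‖ ‖w (n - T)‖
    linarith
  rcases le_max_iff.1 (hmax 0) with h | h
  · left
    have := growth_of_convex (b := fun k => ‖w (k * T)‖) (fun _ => norm_nonneg _)
      (fun k => by rw [add_mul, sub_mul, one_mul]; exact hmax _) (by simpa using h)
    simpa using this
  · right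
    have := growth_of_convex (b := fun k => ‖w (-(k * T))‖) (fun _ => norm_nonneg _)
      (fun k => by
        rw [add_mul, sub_mul, one_mul, max_comm, neg_add, neg_sub, ← sub_eq_add_neg,
          show (T : ℤ) - k * T = -(k * T) + T by ring]
        exact hmax _) (by simpa using h)
    simpa using this

/-! ### Wandering intervals -/

/-- The images of a gap of an invariant set under a diffeomorphism without periodic points get
arbitrarily short. -/
theorem tendsto_length_wandering {f : CircleDeg1Liftˣ} {Q : ℝ → Prop}
    (hper : ∀ n : ℕ, 0 < n → ∀ (k : ℤ) y, (f ^ n) y ≠ k + y)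
    (hQf : ∀ x, Q (f x) ↔ Q x) (hQk : ∀ (k : ℤ) x, Q x → Q (k + x)) {p q : ℝ} (hpq : p < q)
    (hp : Q p) (hgap : ∀ x, p < x → x < q → ¬ Q x) :
    Tendsto (fun n : ℤ => (f ^ n) q - (f ^ n) p) cofinite (𝓝 0) := by
  have hQn : ∀ (n : ℤ) x, Q ((f ^ n) x) ↔ Q x := by
    intro n
    induction n using Int.induction_on with
    | zero => intro x; rfl
    | succ n ih => intro x; rw [zpow_add_one, units_mul_apply, ih, hQf]
    | pred n ih =>
      intro x
      rw [zpow_sub_one, units_mul_apply, ih, ← hQf, units_apply_inv_apply]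
  have hq1 : q ≤ p + 1 := by
    by_contra h
    refine hgap (p + 1) (by linarith) (not_le.1 h) ?_
    have := hQk 1 p hp
    rwa [Int.cast_one, add_comm] at this
  have hlen : ∀ n : ℤ, (f ^ n) q ≤ (f ^ n) p + 1 := fun n => by
    rw [← CircleDeg1Lift.map_add_one]
    exact CircleDeg1Lift.mono _ hq1
  let k : ℤ → ℤ := fun n => -⌊(f ^ n) p⌋
  let I : ℤ → Set ℝ := fun n => Set.Ioo (k n + (f ^ n) p) (k n + (f ^ n) q)
  have hIQ : ∀ n, ∀ z ∈ I n, ¬ Q z := by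
    rintro n z ⟨h1, h2⟩ hz
    have hz' : Q ((f ^ (-n)) (((-k n : ℤ) : ℝ) + z)) := (hQn _ _).2 (hQk _ _ hz)
    have e : ∀ y, (f ^ (-n)) ((f ^ n) y) = y := fun y => by
      rw [← units_mul_apply, ← zpow_add, neg_add_cancel, zpow_zero]; rfl
    have m := units_strictMono (f ^ (-n))
    refine hgap _ ?_ ?_ hz'
    · rw [← e p]; apply m; push_cast; linarith
    · rw [← e q]; apply m; push_cast; linarith
  -- No interval contains a point satisfying `Q`, while left endpoints do satisfy it. Overlapping
  -- intervals thus share their left endpoint, which would be a periodic point of `f` modulo `1`.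
  have hle : ∀ n m z, z ∈ I n → z ∈ I m → k m + (f ^ m) p ≤ k n + (f ^ n) p := by
    intro n m z hn hm
    by_contra h
    exact hIQ n _ ⟨not_le.1 h, hm.1.trans hn.2⟩ (hQk _ _ ((hQn m p).2 hp))
  have hdisj' : ∀ n m : ℤ, n < m → Disjoint (I n) (I m) := by
    intro n m hnm
    rw [Set.disjoint_left]
    intro z hn hm
    have heq := le_antisymm (hle n m z hn hm) (hle m n z hm hn)
    obtain ⟨j, hj⟩ := Int.le.dest hnm.le
    have hj0 : 0 < j := by omega
    refine hper j hj0 (k n - k m) ((f ^ n) p) ?_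
    rw [← zpow_natCast, ← units_mul_apply, ← zpow_add, add_comm, hj]
    push_cast
    linarith
  have hdisj : Pairwise (Function.onFun Disjoint I) := by
    intro n m hnm
    rcases hnm.lt_or_gt with h | h
    · exact hdisj' n m h
    · exact (hdisj' m n h).symm
  have hsub : (⋃ n, I n) ⊆ Set.Ioo 0 2 := by
    refine Set.iUnion_subset fun n z hz => ?_
    have h1 : (k n : ℝ) + (f ^ n) p = Int.fract ((f ^ n) p) := by
      simp only [k, Int.fract]; push_cast; ring
    have h2 := Int.fract_nonneg ((f ^ n) p)
    have h3 := Int.fract_lt_one ((f ^ n) p)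
    have h4 := hlen n
    exact ⟨by linarith [hz.1], by linarith [hz.2]⟩
  -- Of disjoint intervals inside `(0, 2)`, only finitely many have length at least `ε`.
  rw [Metric.tendsto_nhds]
  intro ε hε
  rw [eventually_cofinite]
  refine (MeasureTheory.Measure.finite_const_le_meas_of_disjoint_iUnion MeasureTheory.volume
    (ENNReal.ofReal_pos.2 hε) (As := I) (fun n => measurableSet_Ioo) hdisj ?_).subset ?_
  · exact ne_top_of_le_ne_top (by simp [Real.volume_Ioo]) (MeasureTheory.measure_mono hsub)
  · intro n hn
    rw [Set.mem_ofPred_eq, Real.dist_eq, sub_zero, not_lt,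
      abs_of_pos (sub_pos.2 (units_strictMono _ hpq))] at hn
    simp only [Set.mem_ofPred_eq, I, Real.volume_Ioo]
    exact ENNReal.ofReal_le_ofReal (by linarith)

/-! ### Lifted actions of `ℤ ⋉_A H` -/

/-- An action of `ℤ ⋉_A H` on the line by lifts of circle diffeomorphisms; `e` is a family of
elements of `H` proportional to the standard basis. -/
structure LiftedAction {d : ℕ} (A : GL (Fin d) ℚ) (H : AddSubgroup (Fin d → ℚ)) where
  L : H → CircleDeg1Liftˣ
  a : CircleDeg1Liftˣ
  σ : H ≃+ H
  m : ℕ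
  e : Fin d → H
  L_mem : ∀ h, L h ∈ C1Lift
  a_mem : a ∈ C1Lift
  L_add : ∀ g h, L (g + h) = L g * L h
  σ_apply : ∀ h : H, (σ h : Fin d → ℚ) = (A : Matrix (Fin d) (Fin d) ℚ).mulVec h
  conj : ∀ h, a * L h = L (σ h) * a
  m_pos : 0 < m
  e_apply : ∀ j, (e j : Fin d → ℚ) = Pi.single j (m : ℚ)

namespace LiftedAction

variable {d : ℕ} {A : GL (Fin d) ℚ} {H : AddSubgroup (Fin d → ℚ)} (S : LiftedAction A H)

theorem L_zero : S.L 0 = 1 := by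
  have := S.L_add 0 0
  rw [add_zero] at this
  exact left_eq_mul.1 this

theorem L_nsmul (n : ℕ) (h : H) : S.L (n • h) = S.L h ^ n := by
  induction n with
  | zero => simp [L_zero]
  | succ n ih => rw [succ_nsmul, L_add, ih, pow_succ]

theorem L_neg (h : H) : S.L (-h) = (S.L h)⁻¹ := by
  rw [eq_inv_iff_mul_eq_one, ← L_add, neg_add_cancel, L_zero]

theorem conj_apply (h : H) (x : ℝ) : S.a (S.L h x) = S.L (S.σ h) (S.a x) :=
  congrArg (fun F : CircleDeg1Liftˣ => F x) (S.conj h)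

/-- A positive multiple of every element of `H` is an integral combination of the elements `e`. -/
theorem exists_nsmul_eq_sum (h : H) : ∃ N : ℕ, 0 < N ∧ ∃ c : Fin d → ℤ,
    N • h = ∑ j, c j • S.e j ∧ ∀ j, (c j : ℚ) = N * ((h : Fin d → ℚ) j / S.m) := by
  set D : ℕ := ∏ j, ((h : Fin d → ℚ) j).den with hD
  have hD0 : 0 < D := Finset.prod_pos fun j _ => Rat.den_pos _
  have hc : ∀ j, ∃ c : ℤ, (c : ℚ) = D * (h : Fin d → ℚ) j := fun j => by
    obtain ⟨r, hr⟩ := Finset.dvd_prod_of_mem (fun j => ((h : Fin d → ℚ) j).den)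
      (Finset.mem_univ j)
    refine ⟨r * ((h : Fin d → ℚ) j).num, ?_⟩
    rw [hD, hr]
    push_cast
    rw [mul_comm (_ : ℚ) (r : ℚ), mul_assoc, Rat.den_mul_eq_num]
  choose c hc using hc
  have hm : (S.m : ℚ) ≠ 0 := by exact_mod_cast S.m_pos.ne'
  refine ⟨S.m * D, Nat.mul_pos S.m_pos hD0, c, ?_, fun j => ?_⟩
  · apply Subtype.ext
    funext i
    simp only [AddSubgroup.coe_nsmul, AddSubgroup.val_finsetSum, AddSubgroup.coe_zsmul,
      S.e_apply, Finset.sum_apply, Pi.smul_apply, nsmul_eq_mul, zsmul_eq_mul]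
    rw [Finset.sum_eq_single i (fun j _ hj => by simp [hj.symm]) (by simp), Pi.mul_apply,
      Pi.intCast_apply, Pi.single_eq_same, hc]
    push_cast
    ring
  · rw [hc]; push_cast; field_simp

/-- `H` need not be finitely generated, but a multiple of `h` is a combination of the `e j`, and one
can divide in `ℝ`. -/
theorem apply_eq_sum {l : H → ℝ} (hl : ∀ g h, l (g + h) = l g + l h) (h : H) :
    l h = ∑ j, (((h : Fin d → ℚ) j / S.m : ℚ) : ℝ) * l (S.e j) := by
  obtain ⟨N, hN, c, hc, hcj⟩ := S.exists_nsmul_eq_sum h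
  let l' : H →+ ℝ := AddMonoidHom.mk' l hl
  have h1 : l' (N • h) = ∑ j, c j • l' (S.e j) := by rw [hc, map_sum]; simp
  rw [map_nsmul] at h1
  have hN' : (N : ℝ) ≠ 0 := by exact_mod_cast hN.ne'
  have h2 : ∀ j, (c j : ℝ) = N * (((h : Fin d → ℚ) j / S.m : ℚ) : ℝ) := fun j => by
    have := hcj j
    exact_mod_cast congrArg (fun t : ℚ => (t : ℝ)) this
  change l' h = ∑ j, _ * l' (S.e j)
  rw [nsmul_eq_mul] at h1
  apply mul_left_cancel₀ hN'
  rw [h1, Finset.mul_sum]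
  exact Finset.sum_congr rfl fun j _ => by rw [zsmul_eq_mul, h2]; ring

theorem coeff_σ (i j : Fin d) :
    ((S.σ (S.e i) : Fin d → ℚ) j / S.m) = (A : Matrix (Fin d) (Fin d) ℚ) j i := by
  have hm : (S.m : ℚ) ≠ 0 := by exact_mod_cast S.m_pos.ne'
  rw [S.σ_apply, S.e_apply, Matrix.mulVec_single]
  simp [hm]

/-- The points of the line that are fixed by all of `H`. -/
def Fixed (x : ℝ) : Prop := ∀ h, S.L h x = x

theorem fixed_a_iff (x : ℝ) : S.Fixed (S.a x) ↔ S.Fixed x := by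
  refine ⟨fun hx h => ?_, fun hx h => ?_⟩
  · have := hx (S.σ h)
    rw [← conj_apply] at this
    exact units_injective _ this
  · obtain ⟨g, rfl⟩ := S.σ.surjective h
    rw [← conj_apply, hx]

theorem fixed_zpow_iff (n : ℤ) (x : ℝ) : S.Fixed ((S.a ^ n) x) ↔ S.Fixed x := by
  induction n using Int.induction_on generalizing x with
  | zero => rfl
  | succ n ih => rw [zpow_add_one, units_mul_apply, ih, fixed_a_iff]
  | pred n ih => rw [zpow_sub_one, units_mul_apply, ih, ← fixed_a_iff, units_apply_inv_apply]

theorem fixed_int_add (k : ℤ) {x : ℝ} (hx : S.Fixed x) : S.Fixed (k + x) := fun h => by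
  rw [CircleDeg1Lift.map_int_add, hx]

/-- Some power of `S.L h` fixes `x`, and an increasing map with a power fixing `x` fixes `x`. -/
theorem fixed_of_forall_e {x : ℝ} (hx : ∀ j, S.L (S.e j) x = x) : S.Fixed x := by
  intro h
  obtain ⟨N, hN, c, hc, -⟩ := S.exists_nsmul_eq_sum h
  let K : AddSubgroup H :=
    { carrier := {g | S.L g x = x}
      add_mem' := fun {g g'} hg hg' => by
        change S.L (g + g') x = x
        rw [L_add, units_mul_apply, hg', hg]
      zero_mem' := by change S.L 0 x = x; rw [L_zero]; rfl
      neg_mem' := fun {g} hg => by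
        change S.L (-g) x = x
        rw [L_neg, units_inv_apply_eq_iff]; exact hg.symm }
  have h1 : N • h ∈ K := by
    rw [hc]
    exact K.sum_mem fun j _ => K.zsmul_mem (hx j) _
  have h2 : S.L (N • h) x = x := h1
  rw [L_nsmul] at h2
  exact units_fixed_of_pow_fixed hN h2

end LiftedAction

open Asymptotics

/-! ### The action near the endpoint of a wandering gap -/

theorem tendsto_deriv_of_dist {α : Type*} {l : Filter α} {F : CircleDeg1Liftˣ} (hF : F ∈ C1Lift)
    {x y : α → ℝ} (hxy : Tendsto (fun z => x z - y z) l (𝓝 0)) :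
    Tendsto (fun z => deriv F (x z) - deriv F (y z)) l (𝓝 0) := by
  have hu := Metric.uniformContinuous_iff.1 (C1Lift.uniformContinuous_deriv hF)
  rw [Metric.tendsto_nhds] at hxy ⊢
  intro ε hε
  obtain ⟨δ, hδ, h⟩ := hu ε hε
  filter_upwards [hxy δ hδ] with z hz
  rw [dist_zero_right, ← dist_eq_norm] at hz ⊢
  exact h hz

theorem zpow_deriv_mul {F : CircleDeg1Liftˣ} (hF : F ∈ C1Lift) (n : ℤ) (x : ℝ) :
    deriv (F ^ (n + 1) : CircleDeg1Liftˣ) x =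
      deriv F ((F ^ n) x) * deriv (F ^ n : CircleDeg1Liftˣ) x := by
  rw [add_comm, zpow_one_add, C1Lift.deriv_mul hF (C1Lift.zpow_mem hF n)]

/-- The filter `𝓝[>] p ×ˢ ⊤` expresses convergence as `x → p⁺` uniformly in `n`. For all but
finitely many `n` the image of the whole gap is short; continuity at `p` handles the others. -/
theorem tendsto_orbit_of_tendsto_length {f : CircleDeg1Liftˣ} {p q : ℝ} (hpq : p < q)
    (h : Tendsto (fun n : ℤ => (f ^ n) q - (f ^ n) p) cofinite (𝓝 0)) :
    Tendsto (fun z : ℝ × ℤ => (f ^ z.2) z.1 - (f ^ z.2) p) (𝓝[>] p ×ˢ ⊤) (𝓝 0) := by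
  rw [Metric.tendsto_nhds]
  intro ε hε
  have hfin := eventually_cofinite.1 ((Metric.tendsto_nhds.1 h) ε hε)
  have h1 : ∀ n : ℤ, ∀ᶠ x in 𝓝[>] p, (f ^ n) x - (f ^ n) p < ε := fun n => by
    have hc : Tendsto (fun x => (f ^ n) x - (f ^ n) p) (𝓝 p) (𝓝 ((f ^ n) p - (f ^ n) p)) :=
      ((units_continuous (f ^ n)).sub continuous_const).continuousAt
    rw [sub_self] at hc
    exact (hc.eventually (gt_mem_nhds hε)).filter_mono nhdsWithin_le_nhds
  refine mem_prod_top.2 ?_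
  filter_upwards [(eventually_all_finite hfin).2 fun n _ => h1 n, Ioo_mem_nhdsGT hpq]
    with x hx hxpq n
  have hm := units_strictMono (f ^ n)
  change dist ((f ^ n) x - (f ^ n) p) 0 < ε
  rw [Real.dist_eq, sub_zero, abs_of_pos (sub_pos.2 (hm hxpq.1))]
  by_cases hn : dist ((f ^ n) q - (f ^ n) p) 0 < ε
  · rw [Real.dist_eq, sub_zero, abs_of_pos (sub_pos.2 (hm hpq))] at hn
    linarith [hm hxpq.2]
  · exact hx n hn

namespace LiftedAction

variable {d : ℕ} {A : GL (Fin d) ℚ} {H : AddSubgroup (Fin d → ℚ)} (S : LiftedAction A H)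

/-- The logarithm of the derivative of `h` along the orbit of `p`. -/
noncomputable def logDeriv (p : ℝ) (n : ℤ) (h : H) : ℝ := Real.log (deriv (S.L h) ((S.a ^ n) p))

variable {p : ℝ}

theorem logDeriv_add (hp : S.Fixed p) (n : ℤ) (g h : H) :
    S.logDeriv p n (g + h) = S.logDeriv p n g + S.logDeriv p n h := by
  rw [logDeriv, logDeriv, logDeriv, S.L_add, C1Lift.deriv_mul (S.L_mem g) (S.L_mem h),
    (S.fixed_zpow_iff n p).2 hp h, Real.log_mul (C1Lift.deriv_pos (S.L_mem g) _).ne'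
      (C1Lift.deriv_pos (S.L_mem h) _).ne']

/-- Differentiate `a h = (σ h) a` at a point fixed by `h`: the derivative of `a` cancels. -/
theorem logDeriv_σ (hp : S.Fixed p) (n : ℤ) (h : H) :
    S.logDeriv p (n + 1) (S.σ h) = S.logDeriv p n h := by
  have h1 := C1Lift.deriv_mul S.a_mem (S.L_mem h) ((S.a ^ n) p)
  rw [S.conj, C1Lift.deriv_mul (S.L_mem _) S.a_mem, (S.fixed_zpow_iff n p).2 hp h, mul_comm,
    mul_right_inj' (C1Lift.deriv_pos S.a_mem _).ne'] at h1
  rw [logDeriv, logDeriv, ← h1, add_comm, zpow_one_add]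
  rfl

/-- `h` fixes both ends of each image of the gap, so its derivative equals `1` somewhere between
them; the images shrink and the derivative is uniformly continuous. -/
theorem tendsto_logDeriv {q : ℝ} (hpq : p < q) (hp : S.Fixed p) (hq : S.Fixed q)
    (hlen : Tendsto (fun n : ℤ => (S.a ^ n) q - (S.a ^ n) p) cofinite (𝓝 0)) (h : H) :
    Tendsto (fun n => S.logDeriv p n h) cofinite (𝓝 0) := by
  have hξ : ∀ n : ℤ, ∃ ξ, |ξ - (S.a ^ n) p| ≤ |(S.a ^ n) q - (S.a ^ n) p| ∧
      deriv (S.L h) ξ = 1 := fun n => by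
    obtain ⟨ξ, h1, h2⟩ := C1Lift.mean_value (S.L_mem h) ((S.a ^ n) p) ((S.a ^ n) q)
    refine ⟨ξ, h1, ?_⟩
    rw [(S.fixed_zpow_iff n p).2 hp h, (S.fixed_zpow_iff n q).2 hq h] at h2
    exact (right_eq_mul₀ (sub_pos.2 (units_strictMono _ hpq)).ne').1 h2
  choose ξ hξ1 hξ2 using hξ
  have h1 : Tendsto (fun n => (S.a ^ n) p - ξ n) cofinite (𝓝 0) := by
    rw [tendsto_zero_iff_norm_tendsto_zero]
    refine squeeze_zero (fun _ => norm_nonneg _) (fun n => ?_)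
      (tendsto_zero_iff_norm_tendsto_zero.1 hlen)
    rw [Real.norm_eq_abs, abs_sub_comm]
    exact hξ1 n
  have h2 := tendsto_deriv_of_dist (S.L_mem h) h1
  have h3 : Tendsto (fun n : ℤ => deriv (S.L h) ((S.a ^ n) p)) cofinite (𝓝 1) := by
    have := h2.add_const 1
    simpa only [hξ2, sub_add_cancel, zero_add] using this
  have := h3.log one_ne_zero
  rw [Real.log_one] at this
  exact this

end LiftedAction

/-! ### The transpose of `A` as a hyperbolic operator on `ℂ^d`. -/

section Transpose

variable {d : ℕ} (A : GL (Fin d) ℚ)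

/-- The matrix `A` with complex entries. -/
noncomputable def complexMatrix (A : GL (Fin d) ℚ) : Matrix (Fin d) (Fin d) ℂ :=
  (A : Matrix (Fin d) (Fin d) ℚ).map (algebraMap ℚ ℂ)

theorem complexMatrix_mul_of_mul_eq_one {A A' : GL (Fin d) ℚ} (h : A * A' = 1) :
    complexMatrix A * complexMatrix A' = 1 := by
  rw [complexMatrix, complexMatrix, ← Matrix.map_mul, ← Units.val_mul, h, Units.val_one,
    Matrix.map_one _ (map_zero _) (map_one _)]

/-- The operator on `ℂ^d` given by the transpose of `A`. -/
noncomputable def transposeOperator : ((Fin d → ℂ) →L[ℂ] (Fin d → ℂ))ˣ where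
  val := LinearMap.toContinuousLinearMap (Matrix.toLin' (complexMatrix A).transpose)
  inv := LinearMap.toContinuousLinearMap (Matrix.toLin' (complexMatrix A⁻¹).transpose)
  val_inv := ContinuousLinearMap.ext fun w => by
    change (complexMatrix A).transpose.mulVec ((complexMatrix A⁻¹).transpose.mulVec w) = w
    rw [Matrix.mulVec_mulVec, ← Matrix.transpose_mul,
      complexMatrix_mul_of_mul_eq_one (inv_mul_cancel A), Matrix.transpose_one, Matrix.one_mulVec]
  inv_val := ContinuousLinearMap.ext fun w => by
    change (complexMatrix A⁻¹).transpose.mulVec ((complexMatrix A).transpose.mulVec w) = w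
    rw [Matrix.mulVec_mulVec, ← Matrix.transpose_mul,
      complexMatrix_mul_of_mul_eq_one (mul_inv_cancel A), Matrix.transpose_one, Matrix.one_mulVec]

theorem transposeOperator_apply (w : Fin d → ℂ) (i : Fin d) :
    (transposeOperator A).val w i = ∑ j, (((A : Matrix (Fin d) (Fin d) ℚ) j i : ℚ) : ℂ) * w j :=
  rfl

theorem transposeOperator_hyperbolic {A : GL (Fin d) ℚ} (hA : NoEigenvalueOfNormOne A) (μ : ℂ)
    (hμ : (unitsEnd (transposeOperator A)).HasEigenvalue μ) : ‖μ‖ ≠ 1 := by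
  refine hA μ ?_
  have h : Module.End.HasEigenvalue (Matrix.toLin' (complexMatrix A).transpose) μ := hμ
  rw [Module.End.hasEigenvalue_iff_isRoot_charpoly, Matrix.charpoly_toLin',
    Matrix.charpoly_transpose] at h
  rw [Module.End.hasEigenvalue_iff_isRoot_charpoly, Matrix.charpoly_toLin']
  exact h

end Transpose

theorem not_tendsto_of_growth {u : ℤ → ℝ} {c : ℝ} (hc : 0 < c) {T : ℕ} (hT : 0 < T) (s : ℤ)
    (hs : s = 1 ∨ s = -1)
    (h : ∀ k : ℕ, (3 / 2) ^ k * c ≤ u (s * (k * T))) : ¬ Tendsto u cofinite (𝓝 0) := by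
  intro hu
  have hinj : Function.Injective fun k : ℕ => s * ((k : ℤ) * T) := by
    intro k k' hk
    have hs0 : s ≠ 0 := by rcases hs with rfl | rfl <;> norm_num
    have hT0 : (T : ℤ) ≠ 0 := by exact_mod_cast hT.ne'
    have := mul_right_cancel₀ hT0 (mul_left_cancel₀ hs0 hk)
    exact_mod_cast this
  have h1 := hu.comp hinj.tendsto_cofinite
  rw [Nat.cofinite_eq_atTop] at h1
  obtain ⟨k, hk⟩ := (h1.eventually (gt_mem_nhds hc)).exists
  have h2 := h k
  have h3 : (1 : ℝ) ≤ (3 / 2) ^ k := one_le_pow₀ (by norm_num)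
  simp only [Function.comp] at hk
  nlinarith

namespace LiftedAction

variable {d : ℕ} {A : GL (Fin d) ℚ} {H : AddSubgroup (Fin d → ℚ)} (S : LiftedAction A H) {p : ℝ}

/-- Hyperbolicity of `A` forces all derivatives of `H` to be one at the endpoint of a gap. -/
theorem deriv_eq_one (hA : NoEigenvalueOfNormOne A) {q : ℝ} (hpq : p < q) (hp : S.Fixed p)
    (hq : S.Fixed q)
    (hlen : Tendsto (fun n : ℤ => (S.a ^ n) q - (S.a ^ n) p) cofinite (𝓝 0)) (h : H) (n : ℤ) :
    deriv (S.L h) ((S.a ^ n) p) = 1 := by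
  obtain ⟨T, hT, ε, hε, hgrow⟩ :=
    growth_of_pseudoOrbit (transposeOperator A) (transposeOperator_hyperbolic hA)
  let w : ℤ → Fin d → ℂ := fun k j => (S.logDeriv p (n + k) (S.e j) : ℂ)
  have hw : ∀ k, (transposeOperator A).val (w (k + 1)) = w k := fun k => by
    funext i
    rw [transposeOperator_apply]
    simp only [w]
    rw [← S.logDeriv_σ hp, S.apply_eq_sum (S.logDeriv_add hp (n + k + 1)) (S.σ (S.e i))]
    simp only [S.coeff_σ, add_assoc]
    push_cast
    rfl
  have hwlim : Tendsto (fun k => ‖w k‖) cofinite (𝓝 0) := by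
    have h1 : Tendsto w cofinite (𝓝 0) := by
      rw [tendsto_pi_nhds]
      intro j
      have h2 := (S.tendsto_logDeriv hpq hp hq hlen (S.e j)).comp
        (add_right_injective n).tendsto_cofinite
      exact (Complex.continuous_ofReal.tendsto' 0 0 Complex.ofReal_zero).comp h2
    exact tendsto_zero_iff_norm_tendsto_zero.1 h1
  have hw0 : w 0 = 0 := by
    by_contra hne
    have hpos := norm_pos_iff.2 hne
    -- An exact orbit is a pseudo-orbit with zero error; its growth contradicts decay in both
    -- directions.
    rcases hgrow w (fun k => by rw [hw, sub_self, norm_zero]; positivity) with h1 | h1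
    · exact not_tendsto_of_growth hpos hT 1 (Or.inl rfl) (by simpa using h1) hwlim
    · exact not_tendsto_of_growth hpos hT (-1) (Or.inr rfl) (by simpa using h1) hwlim
  have h0 : S.logDeriv p n h = 0 := by
    rw [S.apply_eq_sum (S.logDeriv_add hp n)]
    refine Finset.sum_eq_zero fun j _ => ?_
    have := congrFun hw0 j
    simp only [w, add_zero, Pi.zero_apply, Complex.ofReal_eq_zero] at this
    rw [this, mul_zero]
  exact Real.eq_one_of_pos_of_log_eq_zero (C1Lift.deriv_pos (S.L_mem h) _) h0

end LiftedAction

/-! ### Displacements near the endpoint of a wandering gap -/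

namespace LiftedAction

variable {d : ℕ} {A : GL (Fin d) ℚ} {H : AddSubgroup (Fin d → ℚ)} (S : LiftedAction A H)

/-- The `n`-th point of the orbit of `x`. -/
def orbitPt (z : ℝ × ℤ) : ℝ := (S.a ^ z.2) z.1

/-- The displacement of `h` at the `n`-th point of the orbit of `x`. -/
def disp (h : H) (z : ℝ × ℤ) : ℝ := S.L h (S.orbitPt z) - S.orbitPt z

/-- The displacements of the elements `e`. -/
def dispVec (z : ℝ × ℤ) : Fin d → ℝ := fun j => S.disp (S.e j) z

theorem orbitPt_succ (z : ℝ × ℤ) : S.orbitPt (z.1, z.2 + 1) = S.a (S.orbitPt z) := by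
  simp only [orbitPt]
  rw [add_comm, zpow_one_add]; rfl

variable {p : ℝ}

theorem tendsto_disp (hp : S.Fixed p)
    (hclose : Tendsto (fun z => S.orbitPt z - (S.a ^ z.2) p) (𝓝[>] p ×ˢ ⊤) (𝓝 0)) (h : H) :
    Tendsto (S.disp h) (𝓝[>] p ×ˢ ⊤) (𝓝 0) := by
  obtain ⟨C, hC0, hC⟩ := C1Lift.deriv_bounded (S.L_mem h)
  rw [tendsto_zero_iff_norm_tendsto_zero] at hclose ⊢
  have h0 : Tendsto (fun z => (C + 1) * ‖S.orbitPt z - (S.a ^ z.2) p‖) (𝓝[>] p ×ˢ ⊤) (𝓝 0) := by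
    simpa using hclose.const_mul (C + 1)
  refine squeeze_zero (fun _ => norm_nonneg _) (fun z => ?_) h0
  obtain ⟨ξ, -, hξ⟩ := C1Lift.mean_value (S.L_mem h) ((S.a ^ z.2) p) (S.orbitPt z)
  rw [(S.fixed_zpow_iff z.2 p).2 hp h] at hξ
  have e : S.disp h z = (deriv (S.L h) ξ - 1) * (S.orbitPt z - (S.a ^ z.2) p) := by
    rw [disp, sub_mul, ← hξ]; ring
  rw [e, norm_mul]
  gcongr
  rw [Real.norm_eq_abs, abs_le]
  have := C1Lift.deriv_pos (S.L_mem h) ξ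
  exact ⟨by linarith, by linarith [hC ξ]⟩

/-- Increments of `F` over the displacement of `h` are given by the derivative of `F` to first
order. -/
theorem isLittleO_increment (hp : S.Fixed p)
    (hclose : Tendsto (fun z => S.orbitPt z - (S.a ^ z.2) p) (𝓝[>] p ×ˢ ⊤) (𝓝 0)) (h : H)
    {F : CircleDeg1Liftˣ} (hF : F ∈ C1Lift) :
    (fun z => F (S.L h (S.orbitPt z)) - F (S.orbitPt z) - deriv F (S.orbitPt z) * S.disp h z)
      =o[𝓝[>] p ×ˢ ⊤] S.disp h := by
  choose ξ hξ1 hξ2 using fun z => C1Lift.mean_value hF (S.orbitPt z) (S.L h (S.orbitPt z))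
  have h1 : Tendsto (fun z => ξ z - S.orbitPt z) (𝓝[>] p ×ˢ ⊤) (𝓝 0) := by
    rw [tendsto_zero_iff_norm_tendsto_zero]
    exact squeeze_zero (fun _ => norm_nonneg _) (fun z => hξ1 z)
      (tendsto_zero_iff_norm_tendsto_zero.1 (S.tendsto_disp hp hclose h))
  have h2 := tendsto_deriv_of_dist hF h1
  have h3 := ((isLittleO_one_iff ℝ).2 h2).mul_isBigO (isBigO_refl (S.disp h) (𝓝[>] p ×ˢ ⊤))
  refine (h3.congr (fun z => ?_) fun z => one_mul _)
  rw [hξ2, disp, sub_mul]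

/-- At `y` the difference is `g (h y) - g y - (h y - y)`, and the derivative of `g` is close to `1`
near the orbit of `p`. -/
theorem isLittleO_disp_add (hp : S.Fixed p)
    (hclose : Tendsto (fun z => S.orbitPt z - (S.a ^ z.2) p) (𝓝[>] p ×ˢ ⊤) (𝓝 0))
    (hderiv : ∀ (h : H) (n : ℤ), deriv (S.L h) ((S.a ^ n) p) = 1) (g h : H) :
    (fun z => S.disp (g + h) z - S.disp g z - S.disp h z) =o[𝓝[>] p ×ˢ ⊤] S.disp h := by
  have h1 := S.isLittleO_increment hp hclose h (S.L_mem g)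
  have h2 := tendsto_deriv_of_dist (S.L_mem g) hclose
  simp only [hderiv] at h2
  have h3 := ((isLittleO_one_iff ℝ).2 h2).mul_isBigO (isBigO_refl (S.disp h) (𝓝[>] p ×ˢ ⊤))
  refine (h1.add (h3.congr (fun z => rfl) fun z => one_mul _)).congr (fun z => ?_) fun z => rfl
  simp only [disp, S.L_add, units_mul_apply]
  ring

theorem isLittleO_disp_nsmul (hp : S.Fixed p)
    (hclose : Tendsto (fun z => S.orbitPt z - (S.a ^ z.2) p) (𝓝[>] p ×ˢ ⊤) (𝓝 0))
    (hderiv : ∀ (h : H) (n : ℤ), deriv (S.L h) ((S.a ^ n) p) = 1) (n : ℕ) (h : H) :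
    (fun z => S.disp (n • h) z - n * S.disp h z) =o[𝓝[>] p ×ˢ ⊤] S.disp h := by
  induction n with
  | zero =>
    refine (isLittleO_zero _ _).congr (fun z => ?_) fun z => rfl
    simp [disp, L_zero]
  | succ n ih =>
    refine (ih.add (S.isLittleO_disp_add hp hclose hderiv (n • h) h)).congr (fun z => ?_)
      fun z => rfl
    rw [succ_nsmul]
    push_cast
    ring

theorem isLittleO_disp_zsmul (hp : S.Fixed p)
    (hclose : Tendsto (fun z => S.orbitPt z - (S.a ^ z.2) p) (𝓝[>] p ×ˢ ⊤) (𝓝 0))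
    (hderiv : ∀ (h : H) (n : ℤ), deriv (S.L h) ((S.a ^ n) p) = 1) (n : ℤ) (h : H) :
    (fun z => S.disp (n • h) z - n * S.disp h z) =o[𝓝[>] p ×ˢ ⊤] S.disp h := by
  obtain ⟨n, rfl | rfl⟩ := n.eq_nat_or_neg
  · simpa using S.isLittleO_disp_nsmul hp hclose hderiv n h
  · have h1 := S.isLittleO_disp_nsmul hp hclose hderiv n h
    have hO : S.disp (n • h) =O[𝓝[>] p ×ˢ ⊤] S.disp h := by
      refine (h1.isBigO.add ((isBigO_refl _ _).const_mul_left (n : ℝ))).congr_left fun z => ?_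
      ring
    have h2 := (S.isLittleO_disp_add hp hclose hderiv (-(n • h)) (n • h)).trans_isBigO hO
    refine (h2.add h1).neg_left.congr (fun z => ?_) fun z => rfl
    have e : S.disp 0 z = 0 := by simp [disp, L_zero]
    rw [neg_add_cancel, e, neg_smul, natCast_zsmul]
    push_cast
    ring

theorem isBigO_disp_dispVec (j : Fin d) (l : Filter (ℝ × ℤ)) : S.disp (S.e j) =O[l] S.dispVec :=
  isBigO_pi.1 (isBigO_refl S.dispVec l) j

theorem isLittleO_disp_sum (hp : S.Fixed p)
    (hclose : Tendsto (fun z => S.orbitPt z - (S.a ^ z.2) p) (𝓝[>] p ×ˢ ⊤) (𝓝 0))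
    (hderiv : ∀ (h : H) (n : ℤ), deriv (S.L h) ((S.a ^ n) p) = 1) (c : Fin d → ℤ)
    (s : Finset (Fin d)) :
    (fun z => S.disp (∑ j ∈ s, c j • S.e j) z - ∑ j ∈ s, c j * S.disp (S.e j) z)
      =o[𝓝[>] p ×ˢ ⊤] S.dispVec := by
  induction s using Finset.induction_on with
  | empty =>
    refine (isLittleO_zero _ _).congr (fun z => ?_) fun z => rfl
    simp [disp, L_zero]
  | insert i s hi ih =>
    have h1 := S.isLittleO_disp_zsmul hp hclose hderiv (c i) (S.e i)
    have hO : S.disp (c i • S.e i) =O[𝓝[>] p ×ˢ ⊤] S.disp (S.e i) := by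
      refine (h1.isBigO.add ((isBigO_refl _ _).const_mul_left (c i : ℝ))).congr_left fun z => ?_
      ring
    have hv := S.isBigO_disp_dispVec i (𝓝[>] p ×ˢ ⊤)
    have h2 := (S.isLittleO_disp_add hp hclose hderiv (∑ j ∈ s, c j • S.e j)
      (c i • S.e i)).trans_isBigO (hO.trans hv)
    refine ((ih.add h2).add (h1.trans_isBigO hv)).congr (fun z => ?_) fun z => rfl
    rw [Finset.sum_insert hi, Finset.sum_insert hi, add_comm (c i • S.e i)]
    ring

/-- To first order, the displacement is a linear function of the element of `H`. -/
theorem isLittleO_disp_linear (hp : S.Fixed p)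
    (hclose : Tendsto (fun z => S.orbitPt z - (S.a ^ z.2) p) (𝓝[>] p ×ˢ ⊤) (𝓝 0))
    (hderiv : ∀ (h : H) (n : ℤ), deriv (S.L h) ((S.a ^ n) p) = 1) (h : H) :
    (fun z => S.disp h z - ∑ j, (((h : Fin d → ℚ) j / S.m : ℚ) : ℝ) * S.disp (S.e j) z)
      =o[𝓝[>] p ×ˢ ⊤] S.dispVec := by
  obtain ⟨N, hN, c, hc, hcj⟩ := S.exists_nsmul_eq_sum h
  have hN' : (N : ℝ) ≠ 0 := by exact_mod_cast hN.ne'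
  have h1 := S.isLittleO_disp_sum hp hclose hderiv c Finset.univ
  rw [← hc] at h1
  have h2 := S.isLittleO_disp_nsmul hp hclose hderiv N h
  have hsum : (fun z => ∑ j, c j * S.disp (S.e j) z) =O[𝓝[>] p ×ˢ ⊤] S.dispVec :=
    IsBigO.fun_sum fun j _ => (S.isBigO_disp_dispVec j _).const_mul_left _
  have hN1 : S.disp (N • h) =O[𝓝[>] p ×ˢ ⊤] S.dispVec :=
    (h1.isBigO.add hsum).congr_left fun z => by ring
  have hself : S.disp h =O[𝓝[>] p ×ˢ ⊤] fun z => (N : ℝ) * S.disp h z :=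
    isBigO_self_const_mul hN' _ _
  -- `h` itself need not be an integral combination of the `e j`, but `N • h` is, and its
  -- displacement is asymptotic to `N` times that of `h`.
  have hO : S.disp h =O[𝓝[>] p ×ˢ ⊤] S.dispVec := by
    refine hself.trans ?_
    have := (h2.trans_isBigO hself).right_isBigO_add
    refine this.trans (hN1.congr_left fun z => ?_)
    ring
  refine ((h1.sub (h2.trans_isBigO hO)).const_mul_left (N : ℝ)⁻¹).congr (fun z => ?_) fun z => rfl
  have hcj' : ∀ j, (c j : ℝ) = N * (((h : Fin d → ℚ) j / S.m : ℚ) : ℝ) := fun j => by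
    have := hcj j
    exact_mod_cast congrArg (fun t : ℚ => (t : ℝ)) this
  simp only [hcj', mul_assoc, ← Finset.mul_sum]
  field_simp
  ring

theorem tendsto_shift (l : Filter ℝ) :
    Tendsto (fun z : ℝ × ℤ => (z.1, z.2 + 1)) (l ×ˢ ⊤) (l ×ˢ ⊤) :=
  tendsto_fst.prodMk tendsto_top

/-- The displacement vectors along an orbit nearly form an orbit of the transpose of `A`, up to
the derivative of `a`. -/
theorem eventually_dispVec_le (hp : S.Fixed p)
    (hclose : Tendsto (fun z => S.orbitPt z - (S.a ^ z.2) p) (𝓝[>] p ×ˢ ⊤) (𝓝 0))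
    (hderiv : ∀ (h : H) (n : ℤ), deriv (S.L h) ((S.a ^ n) p) = 1) {ε : ℝ} (hε : 0 < ε) :
    ∀ᶠ x in 𝓝[>] p, ∀ (n : ℤ) (i : Fin d),
      |∑ j, (((A : Matrix (Fin d) (Fin d) ℚ) j i : ℚ) : ℝ) * S.dispVec (x, n + 1) j -
        deriv S.a (S.orbitPt (x, n)) * S.dispVec (x, n) i| ≤
      ε * (‖S.dispVec (x, n + 1)‖ + deriv S.a (S.orbitPt (x, n)) * ‖S.dispVec (x, n)‖) := by
  obtain ⟨c, hc0, hc⟩ := C1Lift.deriv_bounded_below S.a_mem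
  have key : ∀ i, ∀ᶠ z in 𝓝[>] p ×ˢ (⊤ : Filter ℤ),
      |∑ j, (((A : Matrix (Fin d) (Fin d) ℚ) j i : ℚ) : ℝ) * S.dispVec (z.1, z.2 + 1) j -
        deriv S.a (S.orbitPt z) * S.dispVec z i| ≤
      ε * (‖S.dispVec (z.1, z.2 + 1)‖ + deriv S.a (S.orbitPt z) * ‖S.dispVec z‖) := by
    intro i
    have h1 := (S.isLittleO_disp_linear hp hclose hderiv (S.σ (S.e i))).comp_tendsto
      (tendsto_shift (𝓝[>] p))
    have h2 := (S.isLittleO_increment hp hclose (S.e i) S.a_mem).trans_isBigO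
      (S.isBigO_disp_dispVec i _)
    -- The factor `c` bounds the derivative of `a` from below, so the second error fits under the
    -- term weighted by that derivative.
    filter_upwards [h1.def hε, h2.def (mul_pos hε hc0)] with z hz1 hz2
    simp only [Function.comp, S.coeff_σ, Real.norm_eq_abs] at hz1 hz2
    -- By the conjugation relation, `a` carries a displacement of `e i` to a displacement of `σ (e
    -- i)` at the next orbit point.
    have e : S.a (S.L (S.e i) (S.orbitPt z)) - S.a (S.orbitPt z) =
        S.disp (S.σ (S.e i)) (z.1, z.2 + 1) := by
      rw [disp, orbitPt_succ, conj_apply]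
    rw [e] at hz2
    have h3 : ε * c * ‖S.dispVec z‖ ≤ ε * (deriv S.a (S.orbitPt z) * ‖S.dispVec z‖) := by
      rw [mul_assoc]
      gcongr
      exact hc _
    rw [mul_add]
    change |∑ j, _ * S.disp (S.e j) (z.1, z.2 + 1) - deriv S.a (S.orbitPt z) * S.disp (S.e i) z| ≤ _
    have h4 := abs_sub_le (∑ j, (((A : Matrix (Fin d) (Fin d) ℚ) j i : ℚ) : ℝ) *
      S.disp (S.e j) (z.1, z.2 + 1)) (S.disp (S.σ (S.e i)) (z.1, z.2 + 1))
      (deriv S.a (S.orbitPt z) * S.disp (S.e i) z)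
    rw [abs_sub_comm] at hz1
    linarith
  have h := mem_prod_top.1 (eventually_all.2 key)
  filter_upwards [h] with x hx n i
  exact hx n i

end LiftedAction

/-! ### Normalised displacements and the exclusion of gaps. -/

namespace LiftedAction

variable {d : ℕ} {A : GL (Fin d) ℚ} {H : AddSubgroup (Fin d → ℚ)} (S : LiftedAction A H)

/-- A point of an image of the gap stays in it under `H`, and that image has length at most `1`. -/
theorem norm_dispVec_le {p q x : ℝ} (hp : S.Fixed p) (hq : S.Fixed q) (hq1 : q ≤ p + 1)
    (hpx : p < x) (hxq : x < q) (n : ℤ) : ‖S.dispVec (x, n)‖ ≤ 1 := by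
  refine (pi_norm_le_iff_of_nonneg zero_le_one).2 fun j => ?_
  have hm := units_strictMono (S.a ^ n)
  have hL := units_strictMono (S.L (S.e j))
  have hp' := (S.fixed_zpow_iff n p).2 hp (S.e j)
  have hq' := (S.fixed_zpow_iff n q).2 hq (S.e j)
  have h1 := hm hpx
  have h2 := hm hxq
  have h3 := hL h1
  have h4 := hL h2
  rw [hp'] at h3
  rw [hq'] at h4
  have h5 : (S.a ^ n) q ≤ (S.a ^ n) p + 1 := by
    rw [← CircleDeg1Lift.map_add_one]
    exact CircleDeg1Lift.mono _ hq1
  simp only [dispVec, disp, orbitPt, Real.norm_eq_abs]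
  rw [abs_le]
  exact ⟨by linarith, by linarith⟩

/-- The displacement vectors along the orbit of `x`, normalized by the derivative. -/
noncomputable def normVec (x : ℝ) (n : ℤ) : Fin d → ℂ := fun j =>
  ((S.dispVec (x, n) j / deriv (S.a ^ n : CircleDeg1Liftˣ) x : ℝ) : ℂ)

theorem norm_normVec (x : ℝ) (n : ℤ) :
    ‖S.normVec x n‖ = ‖S.dispVec (x, n)‖ / deriv (S.a ^ n : CircleDeg1Liftˣ) x := by
  have hpos := C1Lift.deriv_pos (C1Lift.zpow_mem S.a_mem n) x
  have h : ∀ r, 0 ≤ r → (‖S.normVec x n‖ ≤ r ↔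
      ‖S.dispVec (x, n)‖ / deriv (S.a ^ n : CircleDeg1Liftˣ) x ≤ r) := fun r hr => by
    rw [pi_norm_le_iff_of_nonneg hr, div_le_iff₀ hpos,
      pi_norm_le_iff_of_nonneg (mul_nonneg hr hpos.le)]
    refine forall_congr' fun j => ?_
    rw [normVec, Complex.norm_real, norm_div, Real.norm_of_nonneg hpos.le, div_le_iff₀ hpos]
  exact le_antisymm ((h _ (by positivity)).2 le_rfl) ((h _ (norm_nonneg _)).1 le_rfl)

/-- Dividing by the derivative of `a ^ (n + 1)` at `x` cancels the factor `deriv S.a`, by the chain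
rule. -/
theorem normVec_pseudoOrbit {x ε : ℝ}
    (hx : ∀ (n : ℤ) (i : Fin d),
      |∑ j, (((A : Matrix (Fin d) (Fin d) ℚ) j i : ℚ) : ℝ) * S.dispVec (x, n + 1) j -
        deriv S.a (S.orbitPt (x, n)) * S.dispVec (x, n) i| ≤
      ε * (‖S.dispVec (x, n + 1)‖ + deriv S.a (S.orbitPt (x, n)) * ‖S.dispVec (x, n)‖))
    (hε : 0 ≤ ε) (n : ℤ) :
    ‖(transposeOperator A).val (S.normVec x (n + 1)) - S.normVec x n‖ ≤
      ε * (‖S.normVec x n‖ + ‖S.normVec x (n + 1)‖) := by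
  refine (pi_norm_le_iff_of_nonneg (by positivity)).2 fun i => ?_
  have hP := C1Lift.deriv_pos (C1Lift.zpow_mem S.a_mem n) x
  have hc := C1Lift.deriv_pos S.a_mem (S.orbitPt (x, n))
  have hmul : deriv (S.a ^ (n + 1) : CircleDeg1Liftˣ) x =
      deriv S.a (S.orbitPt (x, n)) * deriv (S.a ^ n : CircleDeg1Liftˣ) x :=
    zpow_deriv_mul S.a_mem n x
  have hQ := mul_pos hc hP
  rw [norm_normVec, norm_normVec, Pi.sub_apply, transposeOperator_apply, hmul]
  have e : ∑ j, (((A : Matrix (Fin d) (Fin d) ℚ) j i : ℚ) : ℂ) * S.normVec x (n + 1) j -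
      S.normVec x n i =
      (((∑ j, (((A : Matrix (Fin d) (Fin d) ℚ) j i : ℚ) : ℝ) * S.dispVec (x, n + 1) j -
        deriv S.a (S.orbitPt (x, n)) * S.dispVec (x, n) i) /
        (deriv S.a (S.orbitPt (x, n)) * deriv (S.a ^ n : CircleDeg1Liftˣ) x) : ℝ) : ℂ) := by
    simp only [normVec, hmul]
    rw [sub_div, mul_div_mul_left _ _ hc.ne', Finset.sum_div]
    push_cast
    simp only [mul_div_assoc]
  rw [e, Complex.norm_real, norm_div, Real.norm_of_nonneg hQ.le, Real.norm_eq_abs,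
    div_le_iff₀ hQ]
  refine (hx n i).trans_eq ?_
  field_simp
  ring

theorem normVec_zero_ne {x : ℝ} (hx : ¬ S.Fixed x) : S.normVec x 0 ≠ 0 := by
  intro h
  refine hx (S.fixed_of_forall_e fun j => ?_)
  have h1 := congrFun h j
  have hP := C1Lift.deriv_pos (C1Lift.zpow_mem S.a_mem 0) x
  rw [normVec, Pi.zero_apply, Complex.ofReal_eq_zero, div_eq_zero_iff] at h1
  have h2 := h1.resolve_right hP.ne'
  exact sub_eq_zero.1 h2

theorem not_contracted {b : CircleDeg1Liftˣ} (hb : b ∈ C1Lift)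
    (hper : ∀ n : ℕ, 0 < n → ∀ (k : ℤ) y, (b ^ n) y ≠ k + y) {x c : ℝ} (hc : 0 < c)
    (h : ∀ k : ℕ, (3 / 2) ^ k * c ≤ 1 / deriv (b ^ k : CircleDeg1Liftˣ) x) : False := by
  obtain ⟨n, hn, k, y, hy⟩ := C1Lift.exists_periodic_of_contraction hb (x := x) (C := 1 / c)
    (show (1 : ℝ) < 3 / 2 by norm_num) fun k => by
      have h1 := h k
      have hP := C1Lift.deriv_pos (C1Lift.pow_mem hb k) x
      rw [le_div_iff₀ hP] at h1
      rw [le_div_iff₀ hc]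
      linarith
  exact hper n hn k y hy

/-- If `A` is hyperbolic and `a` has no periodic points then `H` has no gap between its common
fixed points. -/
theorem not_gap (hA : NoEigenvalueOfNormOne A)
    (hper : ∀ n : ℕ, 0 < n → ∀ (k : ℤ) y, (S.a ^ n) y ≠ k + y) {p q : ℝ} (hpq : p < q)
    (hp : S.Fixed p) (hq : S.Fixed q) (hgap : ∀ x, p < x → x < q → ¬ S.Fixed x) : False := by
  have hlen := tendsto_length_wandering hper S.fixed_a_iff (fun k x => S.fixed_int_add k) hpq hp
    hgap
  have hclose := tendsto_orbit_of_tendsto_length hpq hlen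
  have hq1 : q ≤ p + 1 := by
    by_contra h
    refine hgap (p + 1) (by linarith) (not_le.1 h) ?_
    have := S.fixed_int_add 1 hp
    rwa [Int.cast_one, add_comm] at this
  obtain ⟨T, hT, ε, hε, hgrow⟩ :=
    growth_of_pseudoOrbit (transposeOperator A) (transposeOperator_hyperbolic hA)
  -- One point of the gap close to `p` serves for all `n` at once, thanks to the uniformity in `n`.
  obtain ⟨x, hx, hpx, hxq⟩ := ((S.eventually_dispVec_le hp hclose
    (S.deriv_eq_one hA hpq hp hq hlen) hε).and (Ioo_mem_nhdsGT hpq)).exists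
  have hw0 := norm_pos_iff.2 (S.normVec_zero_ne (hgap x hpx hxq))
  have hbound : ∀ n, ‖S.normVec x n‖ ≤ 1 / deriv (S.a ^ n : CircleDeg1Liftˣ) x := fun n => by
    have hP := C1Lift.deriv_pos (C1Lift.zpow_mem S.a_mem n) x
    rw [norm_normVec]
    gcongr
    exact S.norm_dispVec_le hp hq hq1 hpx hxq n
  -- Forward growth means contraction along `a ^ T`, backward growth contraction along its inverse.
  rcases hgrow (S.normVec x) (S.normVec_pseudoOrbit hx hε.le) with h | h
  · refine not_contracted (C1Lift.pow_mem S.a_mem T) (fun n hn k y => ?_) hw0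
      (x := x) fun k => (h k).trans ?_
    · rw [← pow_mul]
      exact hper _ (Nat.mul_pos hT hn) k y
    · have := hbound (k * T)
      have e : (S.a ^ T) ^ k = S.a ^ ((k : ℤ) * T) := by
        rw [← pow_mul, ← zpow_natCast, mul_comm]; push_cast; rfl
      rwa [e]
  · refine not_contracted (C1Lift.inv_mem (C1Lift.pow_mem S.a_mem T)) (fun n hn k y hy => ?_) hw0
      (x := x) fun k => (h k).trans ?_
    · rw [inv_pow, ← pow_mul, units_inv_apply_eq_iff, CircleDeg1Lift.map_int_add] at hy
      exact hper _ (Nat.mul_pos hT hn) (-k) y (by rw [Int.cast_neg]; linarith)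
    · have := hbound (-(k * T))
      have e : (S.a ^ T)⁻¹ ^ k = S.a ^ (-((k : ℤ) * T)) := by
        rw [inv_pow, ← pow_mul, zpow_neg, ← zpow_natCast, mul_comm]; push_cast; rfl
      rwa [e]

end LiftedAction

open Polynomial

/-! ### Subgroups of `ℚ^d` invariant under a matrix -/

section Lattice

variable {d : ℕ} {H : AddSubgroup (Fin d → ℚ)}

theorem coe_aeval_eq (β : Module.End ℤ H) (B : Module.End ℚ (Fin d → ℚ))
    (hβ : ∀ h : H, ((β h : H) : Fin d → ℚ) = B h) (p : ℤ[X]) (h : H) :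
    ((aeval β p h : H) : Fin d → ℚ) = aeval B (p.map (algebraMap ℤ ℚ)) (h : Fin d → ℚ) := by
  induction p using Polynomial.induction_on generalizing h with
  | C n => simp
  | add p q hp hq => simp [hp, hq]
  | monomial n c ih =>
    have e1 : aeval β (C c * X ^ (n + 1)) h = aeval β (C c * X ^ n) (β h) := by
      rw [pow_succ, ← mul_assoc, map_mul, aeval_X]; rfl
    have e2 : aeval B ((C c * X ^ (n + 1)).map (algebraMap ℤ ℚ)) (h : Fin d → ℚ) =
        aeval B ((C c * X ^ n).map (algebraMap ℤ ℚ)) (B h) := by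
      rw [pow_succ, ← mul_assoc, Polynomial.map_mul, Polynomial.map_X, map_mul, aeval_X]; rfl
    rw [e1, e2, ih, hβ]

/-- An injective endomorphism of a subgroup of `ℚ^d` has an image of finite exponent. -/
theorem exists_nsmul_eq_apply (β : Module.End ℤ H) (B : Module.End ℚ (Fin d → ℚ))
    (hβ : ∀ h : H, ((β h : H) : Fin d → ℚ) = B h) (hB : LinearMap.det B ≠ 0) :
    ∃ m : ℕ, 0 < m ∧ ∀ h : H, ∃ h' : H, m • h = β h' := by
  obtain ⟨b, hb, hbp⟩ := IsLocalization.integerNormalization_spec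
    (nonZeroDivisors ℤ) (S := ℚ) B.charpoly
  set p := IsLocalization.integerNormalization (nonZeroDivisors ℤ) B.charpoly with hp
  have hb0 : b ≠ 0 := nonZeroDivisors.ne_zero hb
  have hpβ : ∀ h, aeval β p h = 0 := fun h => by
    apply Subtype.ext
    rw [coe_aeval_eq β B hβ, hbp]
    rw [map_zsmul, LinearMap.aeval_self_charpoly]
    simp
  have hp0 : p.coeff 0 ≠ 0 := by
    have h1 := congrArg (fun q => q.coeff 0) hbp
    simp only [coeff_map, coeff_smul] at h1
    intro h0
    rw [h0, map_zero, zsmul_eq_mul, eq_comm, mul_eq_zero] at h1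
    rcases h1 with h1 | h1
    · exact hb0 (by exact_mod_cast h1)
    · rw [LinearMap.det_eq_sign_charpoly_coeff, h1, mul_zero] at hB
      exact hB rfl
  -- Cayley–Hamilton with cleared denominators: `p = X * p.divX + p.coeff 0` kills `β`, and the
  -- constant term is nonzero because `det B` is. Hence `p.coeff 0 • h` lies in the image of `β`.
  have key : ∀ h, β (aeval β p.divX h) + p.coeff 0 • h = 0 := fun h => by
    have h1 := hpβ h
    rw [← p.X_mul_divX_add, map_add, map_mul, aeval_X, aeval_C] at h1
    simpa [Algebra.algebraMap_eq_smul_one] using h1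
  refine ⟨(p.coeff 0).natAbs, Int.natAbs_pos.2 hp0, fun h => ?_⟩
  have h1 := eq_neg_of_add_eq_zero_right (key h)
  rcases Int.natAbs_eq (p.coeff 0) with h2 | h2
  · refine ⟨-(aeval β p.divX h), ?_⟩
    rw [map_neg, ← h1, ← natCast_zsmul, ← h2]
  · refine ⟨aeval β p.divX h, ?_⟩
    rw [h2, neg_smul, natCast_zsmul, neg_inj] at h1
    exact h1

theorem exists_nsmul_single_mem
    (hH : Module.finrank ℚ (Submodule.span ℚ (H : Set (Fin d → ℚ))) = d) :
    ∃ n : ℕ, 0 < n ∧ ∀ j : Fin d, Pi.single j (n : ℚ) ∈ H := by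
  have htop : Submodule.span ℚ (H : Set (Fin d → ℚ)) = ⊤ :=
    Submodule.eq_top_of_finrank_eq (by rw [hH]; simp)
  have h1 : ∀ v ∈ Submodule.span ℚ (H : Set (Fin d → ℚ)), ∃ n : ℕ, 0 < n ∧ n • v ∈ H := by
    intro v hv
    induction hv using Submodule.span_induction with
    | mem v hv => exact ⟨1, one_pos, by simpa using hv⟩
    | zero => exact ⟨1, one_pos, by simp⟩
    | add v w _ _ hv hw =>
      obtain ⟨n, hn, hv⟩ := hv
      obtain ⟨m, hm, hw⟩ := hw
      refine ⟨n * m, Nat.mul_pos hn hm, ?_⟩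
      rw [smul_add]
      refine H.add_mem ?_ ?_
      · rw [mul_comm, mul_smul]; exact H.nsmul_mem hv m
      · rw [mul_smul]; exact H.nsmul_mem hw n
    | smul c v _ hv =>
      obtain ⟨n, hn, hv⟩ := hv
      refine ⟨n * c.den, Nat.mul_pos hn c.den_pos, ?_⟩
      have : (n * c.den) • c • v = c.num • (n • v) := by
        rw [← Nat.cast_smul_eq_nsmul ℚ, ← Nat.cast_smul_eq_nsmul ℚ n,
          ← Int.cast_smul_eq_zsmul ℚ, smul_smul, smul_smul]
        congr 1
        push_cast
        rw [mul_assoc, Rat.den_mul_eq_num, mul_comm]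
      rw [this]
      exact H.zsmul_mem hv _
  have h2 : ∀ j : Fin d, ∃ n : ℕ, 0 < n ∧ n • (Pi.single j 1 : Fin d → ℚ) ∈ H := fun j =>
    h1 _ (htop ▸ Submodule.mem_top)
  choose n hn hnj using h2
  refine ⟨∏ j, n j, Finset.prod_pos fun j _ => hn j, fun j => ?_⟩
  obtain ⟨r, hr⟩ := Finset.dvd_prod_of_mem n (Finset.mem_univ j)
  have e : (Pi.single j ((∏ j, n j : ℕ) : ℚ) : Fin d → ℚ) = r • n j • Pi.single j 1 := by
    rw [hr, smul_smul, ← Pi.single_smul, nsmul_eq_mul, mul_one, mul_comm]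
  rw [e]
  exact H.nsmul_mem (hnj j) r

theorem det_sub_one_ne_zero {A : GL (Fin d) ℚ} (hA : NoEigenvalueOfNormOne A) :
    LinearMap.det (Matrix.toLin' (A : Matrix (Fin d) (Fin d) ℚ) - 1) ≠ 0 := by
  intro h
  have h1 : Matrix.det ((A : Matrix (Fin d) (Fin d) ℚ) - 1) = 0 := by
    rw [← LinearMap.det_toLin', map_sub, Matrix.toLin'_one]
    exact h
  refine hA 1 ?_ norm_one
  rw [Module.End.hasEigenvalue_iff_isRoot_charpoly, Matrix.charpoly_toLin',
    Polynomial.IsRoot, Matrix.eval_charpoly]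
  have h2 : (Matrix.scalar (Fin d) (1 : ℂ) -
      (A : Matrix (Fin d) (Fin d) ℚ).map (algebraMap ℚ ℂ)) =
      -(((A : Matrix (Fin d) (Fin d) ℚ) - 1).map (algebraMap ℚ ℂ)) := by
    rw [Matrix.map_sub _ (map_sub _), Matrix.map_one _ (map_zero _) (map_one _), map_one, neg_sub]
  have h3 : Matrix.det (((A : Matrix (Fin d) (Fin d) ℚ) - 1).map (algebraMap ℚ ℂ)) = 0 := by
    have := (algebraMap ℚ ℂ).map_det ((A : Matrix (Fin d) (Fin d) ℚ) - 1)
    rw [h1, map_zero] at this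
    exact this.symm
  rw [h2, Matrix.det_neg, h3, mul_zero]

end Lattice

/-! ### Common fixed points -/

theorem units_map_iSup {ι : Type*} [Nonempty ι] (F : CircleDeg1Liftˣ) {u : ι → ℝ}
    (hu : BddAbove (Set.range u)) : F (⨆ i, u i) = ⨆ i, F (u i) :=
  (units_strictMono F).monotone.map_ciSup_of_continuousAt (units_continuous F).continuousAt hu

namespace LiftedAction

variable {d : ℕ} {A : GL (Fin d) ℚ} {H : AddSubgroup (Fin d → ℚ)} (S : LiftedAction A H)

/-- The supremum of the orbit of `0` is invariant. It is finite because a lift of translation number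
zero moves `0` to a point below `1`. -/
theorem exists_fixed (hτ : ∀ h, translationNumber (S.L h : CircleDeg1Lift) = 0) :
    ∃ x, S.Fixed x := by
  have hb : BddAbove (Set.range fun h => S.L h 0) := by
    refine ⟨1, ?_⟩
    rintro _ ⟨h, rfl⟩
    have := map_lt_of_translationNumber_lt_int (S.L h : CircleDeg1Lift) (n := 1)
      (by rw [hτ]; norm_num) 0
    simp only [Int.cast_one, zero_add] at this
    exact this.le
  refine ⟨⨆ h, S.L h 0, fun g => ?_⟩
  rw [units_map_iSup _ hb]
  refine Eq.trans ?_ ((Equiv.addLeft g).iSup_comp (g := fun h => S.L h 0))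
  simp only [Equiv.coe_addLeft, S.L_add, units_mul_apply]

theorem isClosed_fixed : IsClosed {x | S.Fixed x} := by
  simp only [Fixed, Set.ofPred_forall]
  exact isClosed_iInter fun h => isClosed_eq (units_continuous _) continuous_id

/-- `C` has points on both sides of `x` by integer translation; the ones nearest to `x` bound the
gap. -/
theorem exists_gap {C : Set ℝ} (hC : IsClosed C) (hk : ∀ (k : ℤ), ∀ x ∈ C, k + x ∈ C)
    {y x : ℝ} (hy : y ∈ C) (hx : x ∉ C) :
    ∃ p q, p < q ∧ p ∈ C ∧ q ∈ C ∧ ∀ z, p < z → z < q → z ∉ C := by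
  obtain ⟨k, hkx⟩ := exists_int_gt (x - y)
  obtain ⟨j, hjx⟩ := exists_int_lt (x - y)
  have hne1 : (C ∩ Set.Iic x).Nonempty := ⟨j + y, hk j y hy, by
    rw [Set.mem_Iic]; linarith⟩
  have hne2 : (C ∩ Set.Ici x).Nonempty := ⟨k + y, hk k y hy, by
    rw [Set.mem_Ici]; linarith⟩
  have hb1 : BddAbove (C ∩ Set.Iic x) := ⟨x, fun z hz => hz.2⟩
  have hb2 : BddBelow (C ∩ Set.Ici x) := ⟨x, fun z hz => hz.2⟩
  have hp := (hC.inter isClosed_Iic).csSup_mem hne1 hb1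
  have hq := (hC.inter isClosed_Ici).csInf_mem hne2 hb2
  have hpx : sSup (C ∩ Set.Iic x) < x := lt_of_le_of_ne hp.2 fun h => hx (h ▸ hp.1)
  have hxq : x < sInf (C ∩ Set.Ici x) := lt_of_le_of_ne hq.2 fun h => hx (h ▸ hq.1)
  refine ⟨_, _, hpx.trans hxq, hp.1, hq.1, fun z h1 h2 hz => ?_⟩
  rcases le_total z x with h | h
  · exact h1.not_ge (le_csSup hb1 ⟨hz, h⟩)
  · exact h2.not_ge (csInf_le hb2 ⟨hz, h⟩)

/-- Either `H` acts trivially, or some common fixed point of `H` is periodic under `a`. -/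
theorem trivial_or_exists_periodic_fixed (hA : NoEigenvalueOfNormOne A)
    (hτ : ∀ h, translationNumber (S.L h : CircleDeg1Lift) = 0) :
    (∀ x, S.Fixed x) ∨
      ∃ n : ℕ, 0 < n ∧ ∃ (k : ℤ) (s : ℝ), S.Fixed s ∧ (S.a ^ n) s = k + s := by
  by_cases hall : ∀ x, S.Fixed x
  · exact Or.inl hall
  right
  obtain ⟨x, hx⟩ := not_forall.1 hall
  obtain ⟨y₀, hy₀⟩ := S.exists_fixed hτ
  obtain ⟨p, q, hpq, hp, hq, hgap⟩ := exists_gap S.isClosed_fixed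
    (fun k x hx => S.fixed_int_add k hx) hy₀ hx
  by_contra hcon
  refine S.not_gap hA (fun n hn k y hy => hcon ?_) hpq hp hq hgap
  -- `b` lifts the same circle map as `a ^ n` and fixes `y`, so its orbits are bounded. The supremum
  -- of the orbit of `p` is fixed by `b` and, by continuity, by all of `H`.
  set b := intTranslate (-k) * S.a ^ n with hb
  have hby : b y = y := by
    rw [hb, units_mul_apply, hy, intTranslate_apply]; push_cast; ring
  have hbdd : BddAbove (Set.range fun j : ℤ => (b ^ j) p) := by
    obtain ⟨N, hN⟩ := exists_int_gt (p - y)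
    refine ⟨N + y, ?_⟩
    rintro _ ⟨j, rfl⟩
    have h1 : (b ^ j) p ≤ (b ^ j) (N + y) := CircleDeg1Lift.mono _ (by linarith)
    rwa [CircleDeg1Lift.map_int_add, units_zpow_fixed hby] at h1
  have hbfix : ∀ x, S.Fixed x → S.Fixed (b x) := fun x hx => by
    rw [hb, units_mul_apply, intTranslate_apply]
    refine S.fixed_int_add _ ?_
    have := (S.fixed_zpow_iff n x).2 hx
    rwa [zpow_natCast] at this
  have hbfix' : ∀ x, S.Fixed x → S.Fixed (b⁻¹ x) := fun x hx => by
    have e : b⁻¹ = intTranslate k * S.a ^ (-(n : ℤ)) := by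
      rw [hb, mul_inv_rev, intTranslate_inv, neg_neg, ← (intTranslate_commute k _).eq, zpow_neg,
        zpow_natCast]
    rw [e, units_mul_apply, intTranslate_apply]
    exact S.fixed_int_add _ ((S.fixed_zpow_iff _ x).2 hx)
  have hbz : ∀ j : ℤ, S.Fixed ((b ^ j) p) := fun j => by
    induction j using Int.induction_on with
    | zero => exact hp
    | succ j ih => rw [add_comm, zpow_one_add]; exact hbfix _ ih
    | pred j ih => rw [sub_eq_neg_add, zpow_add, zpow_neg_one]; exact hbfix' _ ih
  refine ⟨n, hn, k, ⨆ j : ℤ, (b ^ j) p, fun h => ?_, ?_⟩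
  · rw [units_map_iSup _ hbdd]
    exact iSup_congr fun j => hbz j h
  · have h1 : b (⨆ j : ℤ, (b ^ j) p) = ⨆ j : ℤ, (b ^ j) p := by
      rw [units_map_iSup _ hbdd, ← (Equiv.addLeft (1 : ℤ)).iSup_comp (g := fun j => (b ^ j) p)]
      refine iSup_congr fun j => ?_
      rw [Equiv.coe_addLeft, zpow_one_add]; rfl
    have h2 : b (⨆ j : ℤ, (b ^ j) p) = -k + (S.a ^ n) (⨆ j : ℤ, (b ^ j) p) := by
      conv_lhs => rw [hb]
      rw [units_mul_apply, intTranslate_apply, Int.cast_neg]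
    linarith

end LiftedAction

/-! ### Actions of `ℤ ⋉_A H` on the circle -/

theorem Set.Finite.range_of_factorsThrough {α β γ : Type*} {f : α → β} {g : α → γ}
    (hg : (Set.range g).Finite) (h : f.FactorsThrough g) : (Set.range f).Finite := by
  cases isEmpty_or_nonempty α
  · rw [Set.range_eq_empty]; exact Set.finite_empty
  · refine (hg.image (Function.extend g f fun _ => f (Classical.arbitrary α))).subset ?_
    rintro _ ⟨a, rfl⟩
    exact ⟨g a, ⟨a, rfl⟩, h.extend_apply _ a⟩

/-- An action of `ℤ ⋉_A H` on the circle by orientation-preserving `C^1` diffeomorphisms. -/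
structure CircleAction {d : ℕ} (A : GL (Fin d) ℚ) (H : AddSubgroup (Fin d → ℚ)) where
  φ : H → Equiv.Perm UnitAddCircle
  α : Equiv.Perm UnitAddCircle
  σ : H ≃+ H
  φ_mem : ∀ h, φ h ∈ DiffOnePlusCircle
  α_mem : α ∈ DiffOnePlusCircle
  φ_add : ∀ g h, φ (g + h) = φ g * φ h
  σ_apply : ∀ h : H, (σ h : Fin d → ℚ) = (A : Matrix (Fin d) (Fin d) ℚ).mulVec h
  conj : ∀ h, α * φ h = φ (σ h) * α

namespace CircleAction

variable {d : ℕ} {A : GL (Fin d) ℚ} {H : AddSubgroup (Fin d → ℚ)} (S : CircleAction A H)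

theorem φ_zero : S.φ 0 = 1 := by
  have := S.φ_add 0 0
  rw [add_zero] at this
  exact left_eq_mul.1 this

theorem φ_neg (h : H) : S.φ (-h) = (S.φ h)⁻¹ := by
  rw [eq_inv_iff_mul_eq_one, ← φ_add, neg_add_cancel, φ_zero]

theorem φ_commute (g h : H) : Commute (S.φ g) (S.φ h) := by
  rw [commute_iff_eq, ← φ_add, ← φ_add, add_comm]

theorem φ_nsmul (n : ℕ) (h : H) : S.φ (n • h) = S.φ h ^ n := by
  induction n with
  | zero => simp [φ_zero]
  | succ n ih => rw [succ_nsmul, φ_add, ih, pow_succ]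

/-- A lift of the generator of `ℤ`. -/
noncomputable def a : CircleDeg1Liftˣ := (exists_isCircleLift S.α_mem).choose

theorem a_mem : S.a ∈ C1Lift := (exists_isCircleLift S.α_mem).choose_spec.1

theorem a_lift : IsCircleLift S.a S.α := (exists_isCircleLift S.α_mem).choose_spec.2

/-- The map `F` is a lift of `h` with translation number zero. -/
def IsZeroLift (h : H) (F : CircleDeg1Liftˣ) : Prop :=
  F ∈ C1Lift ∧ IsCircleLift F (S.φ h) ∧ translationNumber (F : CircleDeg1Lift) = 0

variable {S}

theorem IsZeroLift.unique {h : H} {F K : CircleDeg1Liftˣ} (hF : S.IsZeroLift h F)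
    (hK : S.IsZeroLift h K) : F = K :=
  hF.2.1.eq_of_translationNumber_eq hK.2.1 (hF.2.2.trans hK.2.2.symm)

theorem translationNumber_mul_of_lifts {g h : H} {F K : CircleDeg1Liftˣ}
    (hF : IsCircleLift F (S.φ g)) (hK : IsCircleLift K (S.φ h)) :
    translationNumber ((F * K : CircleDeg1Liftˣ) : CircleDeg1Lift) =
      translationNumber (F : CircleDeg1Lift) + translationNumber (K : CircleDeg1Lift) := by
  rw [Units.val_mul, translationNumber_mul_of_commute]
  exact (hF.commute hK (S.φ_commute g h)).map (Units.coeHom _)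

theorem IsZeroLift.add {g h : H} {F K : CircleDeg1Liftˣ} (hF : S.IsZeroLift g F)
    (hK : S.IsZeroLift h K) : S.IsZeroLift (g + h) (F * K) := by
  refine ⟨C1Lift.mul_mem hF.1 hK.1, ?_, ?_⟩
  · rw [φ_add]; exact hF.2.1.mul hK.2.1
  · rw [translationNumber_mul_of_lifts hF.2.1 hK.2.1, hF.2.2, hK.2.2, add_zero]

theorem IsZeroLift.neg {h : H} {F : CircleDeg1Liftˣ} (hF : S.IsZeroLift h F) :
    S.IsZeroLift (-h) F⁻¹ := by
  refine ⟨C1Lift.inv_mem hF.1, ?_, ?_⟩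
  · rw [φ_neg]; exact hF.2.1.inv
  · rw [translationNumber_units_inv, hF.2.2, neg_zero]

variable (S) in
theorem isZeroLift_zero : S.IsZeroLift 0 1 :=
  ⟨C1Lift.one_mem, by rw [φ_zero]; exact IsCircleLift.one, translationNumber_one⟩

theorem isCircleLift_conj {h : H} {F : CircleDeg1Liftˣ} (hF : IsCircleLift F (S.φ h)) :
    IsCircleLift (S.a * F * S.a⁻¹) (S.φ (S.σ h)) := by
  have e : S.φ (S.σ h) = S.α * S.φ h * S.α⁻¹ := by rw [S.conj]; group
  rw [e]
  exact (S.a_lift.mul hF).mul S.a_lift.inv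

theorem translationNumber_conj (F : CircleDeg1Liftˣ) :
    translationNumber ((S.a * F * S.a⁻¹ : CircleDeg1Liftˣ) : CircleDeg1Lift) =
      translationNumber (F : CircleDeg1Lift) := by
  rw [Units.val_mul, Units.val_mul, translationNumber_conj_eq]

theorem IsZeroLift.conj {h : H} {F : CircleDeg1Liftˣ} (hF : S.IsZeroLift h F) :
    S.IsZeroLift (S.σ h) (S.a * F * S.a⁻¹) :=
  ⟨C1Lift.mul_mem (C1Lift.mul_mem S.a_mem hF.1) (C1Lift.inv_mem S.a_mem),
    isCircleLift_conj hF.2.1, by rw [translationNumber_conj, hF.2.2]⟩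

theorem IsZeroLift.conj_symm {h : H} {F : CircleDeg1Liftˣ} (hF : S.IsZeroLift h F) :
    S.IsZeroLift (S.σ.symm h) (S.a⁻¹ * F * S.a) := by
  have e : S.φ (S.σ.symm h) = S.α⁻¹ * S.φ h * S.α := by
    have := S.conj (S.σ.symm h)
    rw [AddEquiv.apply_symm_apply] at this
    rw [mul_assoc, ← this]; group
  refine ⟨C1Lift.mul_mem (C1Lift.mul_mem (C1Lift.inv_mem S.a_mem) hF.1) S.a_mem, ?_, ?_⟩
  · rw [e]; exact (S.a_lift.inv.mul hF.2.1).mul S.a_lift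
  · rw [Units.val_mul, Units.val_mul, translationNumber_conj_eq', hF.2.2]

variable (S)

/-- The commutator of lifts `a F a⁻¹ F⁻¹` is a product of commuting maps with opposite translation
numbers. -/
theorem exists_zeroLift_σ_sub (h : H) : ∃ F, S.IsZeroLift (S.σ h - h) F := by
  obtain ⟨F, hF, hFl⟩ := exists_isCircleLift (S.φ_mem h)
  refine ⟨S.a * F * S.a⁻¹ * F⁻¹, C1Lift.mul_mem (C1Lift.mul_mem (C1Lift.mul_mem S.a_mem hF)
    (C1Lift.inv_mem S.a_mem)) (C1Lift.inv_mem hF), ?_, ?_⟩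
  · rw [sub_eq_add_neg, φ_add, φ_neg]
    exact (isCircleLift_conj hFl).mul hFl.inv
  · have hneg : IsCircleLift F⁻¹ (S.φ (-h)) := by rw [φ_neg]; exact hFl.inv
    rw [translationNumber_mul_of_lifts (isCircleLift_conj hFl) hneg, translationNumber_conj,
      translationNumber_units_inv, add_neg_cancel]

/-- The elements of `H` with rotation number zero. -/
def rotKer : AddSubgroup (Fin d → ℚ) where
  carrier := {v | ∃ hv : v ∈ H, ∃ F, S.IsZeroLift ⟨v, hv⟩ F}
  add_mem' := by
    rintro v w ⟨hv, F, hF⟩ ⟨hw, K, hK⟩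
    exact ⟨H.add_mem hv hw, F * K, hF.add hK⟩
  zero_mem' := ⟨H.zero_mem, 1, S.isZeroLift_zero⟩
  neg_mem' := by
    rintro v ⟨hv, F, hF⟩
    exact ⟨H.neg_mem hv, F⁻¹, hF.neg⟩

/-- The inclusion of `rotKer` into `H`. -/
def incl (v : S.rotKer) : H := ⟨v.1, v.2.choose⟩

theorem incl_add (v w : S.rotKer) : S.incl (v + w) = S.incl v + S.incl w := rfl

/-- The lift of an element of rotation number zero that has translation number zero. -/
noncomputable def zeroLift (v : S.rotKer) : CircleDeg1Liftˣ := v.2.choose_spec.choose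

theorem zeroLift_spec (v : S.rotKer) : S.IsZeroLift (S.incl v) (S.zeroLift v) :=
  v.2.choose_spec.choose_spec

theorem mem_rotKer {h : H} (hF : ∃ F, S.IsZeroLift h F) : (h : Fin d → ℚ) ∈ S.rotKer :=
  ⟨h.2, hF⟩

/-- The action of the generator of `ℤ` on `rotKer`. -/
def rotKerEquiv : S.rotKer ≃+ S.rotKer where
  toFun v := ⟨S.σ (S.incl v), S.mem_rotKer ⟨_, (S.zeroLift_spec v).conj⟩⟩
  invFun v := ⟨S.σ.symm (S.incl v), S.mem_rotKer ⟨_, (S.zeroLift_spec v).conj_symm⟩⟩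
  left_inv v := Subtype.ext (by
    change ((S.σ.symm (S.σ (S.incl v)) : H) : Fin d → ℚ) = v
    rw [AddEquiv.symm_apply_apply]; rfl)
  right_inv v := Subtype.ext (by
    change ((S.σ (S.σ.symm (S.incl v)) : H) : Fin d → ℚ) = v
    rw [AddEquiv.apply_symm_apply]; rfl)
  map_add' v w := Subtype.ext (by
    change ((S.σ (S.incl (v + w)) : H) : Fin d → ℚ) = S.σ (S.incl v) + S.σ (S.incl w)
    rw [incl_add, map_add]; rfl)

/-- Some positive multiple of every element of `H` has rotation number zero. -/
theorem exists_nsmul_zeroLift (hA : NoEigenvalueOfNormOne A) :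
    ∃ m : ℕ, 0 < m ∧ ∀ h : H, ∃ F, S.IsZeroLift (m • h) F := by
  obtain ⟨m, hm, h⟩ := exists_nsmul_eq_apply
    ((S.σ : H →+ H).toIntLinearMap - LinearMap.id)
    (Matrix.toLin' (A : Matrix (Fin d) (Fin d) ℚ) - 1)
    (fun h => by simp [S.σ_apply]) (det_sub_one_ne_zero hA)
  refine ⟨m, hm, fun g => ?_⟩
  obtain ⟨g', hg'⟩ := h g
  rw [hg']
  exact S.exists_zeroLift_σ_sub g'

theorem exists_liftedAction (hA : NoEigenvalueOfNormOne A)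
    (hH : Module.finrank ℚ (Submodule.span ℚ (H : Set (Fin d → ℚ))) = d) :
    ∃ T : LiftedAction A S.rotKer, T.L = S.zeroLift ∧ T.a = S.a := by
  obtain ⟨m, hm, hmz⟩ := S.exists_nsmul_zeroLift hA
  obtain ⟨n, hn, hnj⟩ := exists_nsmul_single_mem hH
  have he : ∀ j, Pi.single j ((m * n : ℕ) : ℚ) ∈ S.rotKer := fun j => by
    have := S.mem_rotKer (hmz ⟨_, hnj j⟩)
    rw [AddSubgroup.coe_nsmul, ← Pi.single_smul, nsmul_eq_mul] at this
    push_cast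
    exact this
  exact ⟨{  L := S.zeroLift
            a := S.a
            σ := S.rotKerEquiv
            m := m * n
            e := fun j => ⟨_, he j⟩
            L_mem := fun v => (S.zeroLift_spec v).1
            a_mem := S.a_mem
            L_add := fun v w =>
              (S.zeroLift_spec (v + w)).unique ((S.zeroLift_spec v).add (S.zeroLift_spec w))
            σ_apply := fun v => S.σ_apply (S.incl v)
            conj := fun v => by
              have h1 : S.zeroLift (S.rotKerEquiv v) = S.a * S.zeroLift v * S.a⁻¹ :=
                (S.zeroLift_spec (S.rotKerEquiv v)).unique (S.zeroLift_spec v).conj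
              rw [h1]; group
            m_pos := Nat.mul_pos hm hn
            e_apply := fun j => rfl }, rfl, rfl⟩

/-- The orbit under `H` of a fixed point of `rotKer` is finite. -/
theorem finite_range_of_fixed (hA : NoEigenvalueOfNormOne A) {x : ℝ}
    (hx : ∀ (h : H) F, S.IsZeroLift h F → F x = x) :
    (Set.range fun h : H => S.φ h (x : UnitAddCircle)).Finite := by
  obtain ⟨m, hm, hmz⟩ := S.exists_nsmul_zeroLift hA
  have hm0 : (m : ℝ) ≠ 0 := by exact_mod_cast hm.ne'
  -- As `m • h` has rotation number zero, `h` has a lift with translation number `j / m`, `0 ≤ j <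
  -- m`.
  have hlift : ∀ h : H, ∃ j : ℕ, j < m ∧ ∃ F ∈ C1Lift, IsCircleLift F (S.φ h) ∧
      m * translationNumber (F : CircleDeg1Lift) = j := by
    intro h
    obtain ⟨F, hF, hFl⟩ := exists_isCircleLift (S.φ_mem h)
    obtain ⟨K, hK⟩ := hmz h
    have h1 : IsCircleLift (F ^ m) (S.φ (m • h)) := by
      rw [φ_nsmul]; exact hFl.pow m
    obtain ⟨k, hk⟩ := hK.2.1.exists_eq_intTranslate_mul h1
    have h2 : m * translationNumber (F : CircleDeg1Lift) = k := by
      rw [← translationNumber_pow, ← Units.val_pow_eq_pow_val, hk,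
        translationNumber_intTranslate_mul, hK.2.2, add_zero]
    have hmz0 : (m : ℤ) ≠ 0 := by exact_mod_cast hm.ne'
    obtain ⟨j, hj⟩ := Int.eq_ofNat_of_zero_le (Int.emod_nonneg k hmz0)
    refine ⟨j, ?_, intTranslate (-(k / m)) * F, C1Lift.mul_mem (intTranslate_mem_C1Lift _) hF,
      hFl.intTranslate_mul _, ?_⟩
    · have := Int.emod_lt_of_pos k (show (0 : ℤ) < m by exact_mod_cast hm)
      omega
    · rw [translationNumber_intTranslate_mul, mul_add, h2]
      have := Int.emod_def k m
      rw [hj] at this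
      have h3 : (j : ℝ) = k - m * (k / m : ℤ) := by exact_mod_cast this
      rw [h3]; push_cast; ring
  choose j hj F hF hFl hτ using hlift
  -- Elements with equal `j` differ by one of rotation number zero, whose zero lift fixes `x`; so
  -- `j` determines the image of `x`.
  have hfac : Function.FactorsThrough (fun h : H => S.φ h (x : UnitAddCircle)) j := by
    intro g h hgh
    have hz : S.IsZeroLift (g + -h) (F g * (F h)⁻¹) := by
      have hneg : IsCircleLift (F h)⁻¹ (S.φ (-h)) := by rw [φ_neg]; exact (hFl h).inv
      refine ⟨C1Lift.mul_mem (hF g) (C1Lift.inv_mem (hF h)), ?_, ?_⟩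
      · rw [φ_add]
        exact (hFl g).mul hneg
      · rw [translationNumber_mul_of_lifts (hFl g) hneg, translationNumber_units_inv]
        have : m * translationNumber (F g : CircleDeg1Lift) =
            m * translationNumber (F h : CircleDeg1Lift) := by rw [hτ, hτ, hgh]
        rw [mul_left_cancel₀ hm0 this, add_neg_cancel]
    have h1 : S.φ (g + -h) (x : UnitAddCircle) = x := by rw [hz.2.1, hx _ _ hz]
    have h2 : S.φ g = S.φ h * S.φ (g + -h) := by
      rw [← φ_add]; congr 1; abel
    change S.φ g x = S.φ h x
    rw [h2, Equiv.Perm.mul_apply, h1]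
  refine Set.Finite.range_of_factorsThrough ((Set.finite_lt_nat m).subset ?_) hfac
  rintro _ ⟨h, rfl⟩
  exact hj h

/-- A non-commutative action of `ℤ ⋉_A H` has a finite orbit. -/
theorem exists_finite_orbit (hA : NoEigenvalueOfNormOne A)
    (hH : Module.finrank ℚ (Submodule.span ℚ (H : Set (Fin d → ℚ))) = d)
    (hnc : ¬ ∀ h, Commute S.α (S.φ h)) :
    ∃ x : UnitAddCircle, (Set.range fun z : H × ℤ => S.φ z.1 ((S.α ^ z.2) x)).Finite := by
  obtain ⟨T, hTL, hTa⟩ := S.exists_liftedAction hA hH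
  have hfixed : ∀ x, T.Fixed x → ∀ (h : H) F, S.IsZeroLift h F → F x = x := by
    intro x hx h F hF
    have h1 := hx ⟨h, S.mem_rotKer ⟨F, hF⟩⟩
    rw [hTL, (S.zeroLift_spec ⟨h, S.mem_rotKer ⟨F, hF⟩⟩).unique hF] at h1
    exact h1
  rcases T.trivial_or_exists_periodic_fixed hA
    (fun v => by rw [hTL]; exact (S.zeroLift_spec v).2.2) with hall | ⟨n, hn, k, s, hs, hsn⟩
  · refine absurd (fun h => ?_) hnc
    obtain ⟨F, hF⟩ := S.exists_zeroLift_σ_sub h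
    -- `σ h - h` has rotation number zero, hence acts trivially here; this says that `α` commutes
    -- with `φ h`.
    have h1 : S.φ (S.σ h - h) = 1 := by
      ext x
      obtain ⟨x, rfl⟩ := QuotientAddGroup.mk_surjective x
      have := hF.2.1 x
      rw [hfixed x (hall x) _ F hF] at this
      exact this
    rw [sub_eq_add_neg, φ_add, φ_neg, mul_inv_eq_one] at h1
    rw [commute_iff_eq, S.conj, h1]
  · refine ⟨(s : UnitAddCircle), ?_⟩
    have hperiod : (S.α ^ n) (s : UnitAddCircle) = s := by
      rw [S.a_lift.pow n, ← hTa, hsn, eq_comm, coe_eq_coe_iff_exists_int]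
      exact ⟨k, rfl⟩
    have hr : ∀ r : ℕ, (Set.range fun h : H => S.φ h ((S.α ^ r) (s : UnitAddCircle))).Finite := by
      intro r
      rw [S.a_lift.pow r]
      refine S.finite_range_of_fixed hA (hfixed _ ?_)
      have := (T.fixed_zpow_iff r s).2 hs
      rwa [zpow_natCast, hTa] at this
    refine ((Set.finite_lt_nat n).biUnion fun r _ => hr r).subset ?_
    rintro _ ⟨⟨h, k⟩, rfl⟩
    have hn0 : (n : ℤ) ≠ 0 := by exact_mod_cast hn.ne'
    obtain ⟨r, hr⟩ := Int.eq_ofNat_of_zero_le (Int.emod_nonneg k hn0)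
    have hrn : r < n := by
      have := Int.emod_lt_of_pos k (show (0 : ℤ) < n by exact_mod_cast hn)
      omega
    refine Set.mem_biUnion (show r ∈ {i | i < n} from hrn) ⟨h, ?_⟩
    have e : S.α ^ k = S.α ^ r * (S.α ^ n) ^ (k / n) := by
      rw [← zpow_natCast, ← zpow_natCast, ← zpow_mul, ← zpow_add, ← hr, Int.emod_add_mul_ediv]
    have e2 : ((S.α ^ n) ^ (k / n)) (s : UnitAddCircle) = s :=
      Function.IsFixedPt.perm_zpow hperiod _
    change S.φ h ((S.α ^ r) (s : UnitAddCircle)) = S.φ h ((S.α ^ k) (s : UnitAddCircle))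
    rw [e, Equiv.Perm.mul_apply, e2]

end CircleAction

/-! ### Minimal sets of actions with a finite orbit -/

theorem cantorSet_infinite : cantorSet.Infinite := by
  have h : ∀ n : ℕ, (1 / 3 : ℝ) ^ n * (1 / 4) ∈ cantorSet := fun n => by
    induction n with
    | zero => simpa using quarter_mem_cantorSet
    | succ n ih =>
      rw [cantorSet_eq_union_halves]
      exact Or.inl ⟨_, ih, by ring⟩
  refine Set.infinite_of_injective_forall_mem (f := fun n : ℕ => (1 / 3 : ℝ) ^ n * (1 / 4)) ?_ h
  intro n m hnm
  have h1 : (1 / 3 : ℝ) ^ n = (1 / 3) ^ m := mul_right_cancel₀ (by norm_num) hnm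
  exact pow_right_injective₀ (by norm_num) (by norm_num) h1

section Minimal

variable {G : Type*} [Group G] {ρ : G →* DiffOnePlusCircle}

theorem circleOrbit_invariant (x : UnitAddCircle) (g : G) :
    ∀ y ∈ circleOrbit ρ x, (ρ g : Equiv.Perm UnitAddCircle) y ∈ circleOrbit ρ x := by
  rintro _ ⟨h, rfl⟩
  exact ⟨g * h, by simp⟩

/-- An orientation-preserving diffeomorphism fixing `t` and preserving `K` fixes the last point of
`K` before coming back to `t`. -/
theorem exists_common_fixed_of_stabilizer {K : Set UnitAddCircle} (hK : K.Nonempty)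
    (hKc : IsClosed K) {t : ℝ} :
    ∃ z : UnitAddCircle, z ∈ K ∧ ∀ f ∈ DiffOnePlusCircle, f (t : UnitAddCircle) = t →
      (∀ x ∈ K, f x ∈ K) → (∀ x ∈ K, f⁻¹ x ∈ K) → f z = z := by
  set C : Set ℝ := Set.Icc t (t + 1) ∩ {y | (y : UnitAddCircle) ∈ K} with hC
  have hCc : IsCompact C :=
    isCompact_Icc.inter_right (hKc.preimage (AddCircle.continuous_mk' 1))
  have hCne : C.Nonempty := by
    obtain ⟨x, hx⟩ := hK
    obtain ⟨y, rfl⟩ := QuotientAddGroup.mk_surjective x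
    refine ⟨t + Int.fract (y - t), ⟨by linarith [Int.fract_nonneg (y - t)],
      by linarith [Int.fract_lt_one (y - t)]⟩, ?_⟩
    have : ((t + Int.fract (y - t) : ℝ) : UnitAddCircle) = (y : UnitAddCircle) := by
      rw [coe_eq_coe_iff_exists_int]
      exact ⟨⌊y - t⌋, by rw [Int.fract]; ring⟩
    change ((t + Int.fract (y - t) : ℝ) : UnitAddCircle) ∈ K
    rw [this]; exact hx
  obtain ⟨z, ⟨hzI, hzK⟩, hmax⟩ := hCc.exists_isMaxOn hCne continuousOn_id
  -- A lift fixing `t` preserves `[t, t + 1]` and hence `C`, so it cannot move the maximum `z`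
  -- upwards. The same for the inverse gives equality.
  have key : ∀ f ∈ DiffOnePlusCircle, f (t : UnitAddCircle) = t → (∀ x ∈ K, f x ∈ K) →
      ∀ F, IsCircleLift F f → F t = t → F z ≤ z := by
    intro f hf hft hfK F hF hFt
    refine hmax ⟨⟨?_, ?_⟩, ?_⟩
    · rw [← hFt]; exact CircleDeg1Lift.mono _ hzI.1
    · have := CircleDeg1Lift.mono F.1 hzI.2
      rwa [CircleDeg1Lift.map_add_one, hFt] at this
    · change ((F z : ℝ) : UnitAddCircle) ∈ K
      rw [← hF]; exact hfK _ hzK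
  refine ⟨z, hzK, fun f hf hft hfK hfK' => ?_⟩
  obtain ⟨F₀, -, hF₀⟩ := exists_isCircleLift hf
  obtain ⟨k, hk⟩ := coe_eq_coe_iff_exists_int.1 (hft.symm.trans (hF₀ t))
  set F := intTranslate (-k) * F₀ with hFdef
  have hF : IsCircleLift F f := hF₀.intTranslate_mul _
  have hFt : F t = t := by
    rw [hFdef, units_mul_apply, intTranslate_apply, hk]; push_cast; ring
  have h1 := key f hf hft hfK F hF hFt
  have hft' : f⁻¹ (t : UnitAddCircle) = t := by rw [Equiv.Perm.inv_eq_iff_eq]; exact hft.symm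
  have h2 := key f⁻¹ (DiffOnePlusCircle.inv_mem hf) hft' hfK' F⁻¹ hF.inv
    ((units_inv_apply_eq_iff F t t).2 hFt.symm)
  have h3 := CircleDeg1Lift.mono F.1 h2
  have h4 : F (F⁻¹ z) = z := by simp
  have h5 : F z = z := le_antisymm h1 (by linarith)
  rw [hF, h5]

/-- If `K` misses the finite orbit, the stabilizer of `o` fixes a point `z` of `K`. The orbit of `z`
is then an image of the orbit of `o`, so it is finite, and minimality puts `K` inside it. -/
theorem IsMinimalSet.finite_of_finite_orbit {K : Set UnitAddCircle} (hK : IsMinimalSet ρ K)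
    {o : UnitAddCircle} (ho : (circleOrbit ρ o).Finite) : K.Finite := by
  obtain ⟨hne, hcl, hinv⟩ := hK.prop
  by_cases hoK : o ∈ K
  · refine ho.subset (hK.le_of_le ⟨⟨o, 1, by simp⟩, ho.isClosed, circleOrbit_invariant o⟩ ?_)
    rintro _ ⟨g, rfl⟩
    exact hinv g o hoK
  · obtain ⟨t, rfl⟩ := QuotientAddGroup.mk_surjective o
    obtain ⟨z, hzK, hz⟩ := exists_common_fixed_of_stabilizer hne hcl (t := t)
    have hstab : ∀ g : G, (ρ g : Equiv.Perm UnitAddCircle) (t : UnitAddCircle) = t →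
        (ρ g : Equiv.Perm UnitAddCircle) z = z := fun g hg => by
      refine hz _ (ρ g).2 hg (hinv g) ?_
      have := hinv g⁻¹
      simpa using this
    have hfin : (circleOrbit ρ z).Finite := by
      refine Set.Finite.range_of_factorsThrough ho fun g h hgh => ?_
      have h1 := hstab (h⁻¹ * g) (by
        have hgh' : (ρ g : Equiv.Perm UnitAddCircle) (t : UnitAddCircle) =
          (ρ h : Equiv.Perm UnitAddCircle) (t : UnitAddCircle) := hgh
        rw [map_mul, Subgroup.coe_mul, Equiv.Perm.mul_apply, hgh', map_inv, Subgroup.coe_inv,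
          Equiv.Perm.inv_eq_iff_eq])
      rw [map_mul, Subgroup.coe_mul, Equiv.Perm.mul_apply, map_inv, Subgroup.coe_inv,
        Equiv.Perm.inv_eq_iff_eq] at h1
      exact h1
    refine hfin.subset (hK.le_of_le ⟨⟨z, 1, by simp⟩, hfin.isClosed, circleOrbit_invariant z⟩ ?_)
    rintro _ ⟨g, rfl⟩
    exact hinv g z hzK

theorem not_isExceptionalMinimalSet_of_finite_orbit {o : UnitAddCircle}
    (ho : (circleOrbit ρ o).Finite) (K : Set UnitAddCircle) : ¬ IsExceptionalMinimalSet ρ K := by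
  rintro ⟨hK, ⟨e⟩⟩
  have h1 := (hK.finite_of_finite_orbit ho).to_subtype
  have h2 : Finite cantorSet := Finite.of_equiv K e.toEquiv
  exact cantorSet_infinite cantorSet.toFinite

end Minimal

/-! ### The action of `G` as an action of `ℤ ⋉_A H` -/

section ToCircleAction

variable {d : ℕ} {A : GL (Fin d) ℚ} {H : AddSubgroup (Fin d → ℚ)}
  {G : Subgroup (ZSemidirect A)}

/-- The element of `G` given by an element of `H`. -/
def IsZSemidirectWith.inl (hG : IsZSemidirectWith G H) (h : H) : G :=
  ⟨SemidirectProduct.inl (Multiplicative.ofAdd (h : Fin d → ℚ)), (hG _).2 h.2⟩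

/-- The generator of `ℤ` in `G`. -/
def IsZSemidirectWith.gen (hG : IsZSemidirectWith G H) : G :=
  ⟨SemidirectProduct.inr (Multiplicative.ofAdd 1), (hG _).2 H.zero_mem⟩

theorem ZSemidirect.inr_mul_inl (v : Fin d → ℚ) :
    (SemidirectProduct.inr (Multiplicative.ofAdd 1) *
      SemidirectProduct.inl (Multiplicative.ofAdd v) : ZSemidirect A) =
    SemidirectProduct.inl (Multiplicative.ofAdd ((A : Matrix (Fin d) (Fin d) ℚ).mulVec v)) *
      SemidirectProduct.inr (Multiplicative.ofAdd 1) := by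
  have h := SemidirectProduct.inl_aut
    (φ := zpowersHom (MulAut (Multiplicative (Fin d → ℚ))) (matrixMulAut A))
    (Multiplicative.ofAdd 1) (Multiplicative.ofAdd v)
  rw [map_inv, ← mul_inv_eq_iff_eq_mul.symm.trans eq_comm, zpowersHom_apply, toAdd_ofAdd,
    zpow_one] at h
  exact h

theorem ZSemidirect.inr_inv_mul_inl (v : Fin d → ℚ) :
    ((SemidirectProduct.inr (Multiplicative.ofAdd 1))⁻¹ *
      SemidirectProduct.inl (Multiplicative.ofAdd v) *
      SemidirectProduct.inr (Multiplicative.ofAdd 1) : ZSemidirect A).left =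
      Multiplicative.ofAdd (((A⁻¹ : GL (Fin d) ℚ) : Matrix (Fin d) (Fin d) ℚ).mulVec v) := by
  rw [mul_assoc, eq_comm]
  have h := ZSemidirect.inr_mul_inl (A := A)
    (((A⁻¹ : GL (Fin d) ℚ) : Matrix (Fin d) (Fin d) ℚ).mulVec v)
  rw [Matrix.mulVec_mulVec, ← Units.val_mul, mul_inv_cancel, Units.val_one,
    Matrix.one_mulVec] at h
  rw [← h, inv_mul_cancel_left, SemidirectProduct.left_inl]

/-- The automorphism of `H` given by `A`. -/
def IsZSemidirectWith.equiv (hG : IsZSemidirectWith G H) : H ≃+ H where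
  toFun h := ⟨(A : Matrix (Fin d) (Fin d) ℚ).mulVec h, by
    have h1 := (hG _).1 (G.mul_mem (hG.gen * hG.inl h).2 (G.inv_mem hG.gen.2))
    have h2 : ((hG.gen * hG.inl h : G) : ZSemidirect A) * (hG.gen : ZSemidirect A)⁻¹ =
        SemidirectProduct.inl
          (Multiplicative.ofAdd ((A : Matrix (Fin d) (Fin d) ℚ).mulVec h)) := by
      rw [mul_inv_eq_iff_eq_mul]
      exact ZSemidirect.inr_mul_inl (h : Fin d → ℚ)
    rw [h2] at h1
    exact h1⟩
  invFun h := ⟨((A⁻¹ : GL (Fin d) ℚ) : Matrix (Fin d) (Fin d) ℚ).mulVec h, by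
    have h1 := (hG _).1 (G.mul_mem (G.mul_mem (G.inv_mem hG.gen.2) (hG.inl h).2) hG.gen.2)
    have h2 := ZSemidirect.inr_inv_mul_inl (A := A) (h : Fin d → ℚ)
    exact (congrArg (fun v : Multiplicative (Fin d → ℚ) => v.toAdd ∈ H) h2).mp h1⟩
  left_inv h := Subtype.ext (by
    simp [Matrix.mulVec_mulVec, ← Units.val_mul, -Matrix.coe_units_inv])
  right_inv h := Subtype.ext (by
    simp [Matrix.mulVec_mulVec, ← Units.val_mul, -Matrix.coe_units_inv])
  map_add' g h := Subtype.ext (by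
    change (A : Matrix (Fin d) (Fin d) ℚ).mulVec ((g : Fin d → ℚ) + h) = _
    rw [Matrix.mulVec_add]; rfl)

/-- The action of `ℤ ⋉_A H` on the circle given by a representation of `G`. -/
def IsZSemidirectWith.circleAction (hG : IsZSemidirectWith G H) (ρ : G →* DiffOnePlusCircle) :
    CircleAction A H where
  φ h := ρ (hG.inl h)
  α := ρ hG.gen
  σ := hG.equiv
  φ_mem h := (ρ (hG.inl h)).2
  α_mem := (ρ hG.gen).2
  φ_add g h := by
    rw [← Subgroup.coe_mul, ← map_mul]
    congr 2
  σ_apply h := rfl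
  conj h := by
    rw [← Subgroup.coe_mul, ← Subgroup.coe_mul, ← map_mul, ← map_mul]
    congr 2
    exact Subtype.ext (ZSemidirect.inr_mul_inl (h : Fin d → ℚ))

theorem IsZSemidirectWith.exists_eq_mul (hG : IsZSemidirectWith G H) (g : G) :
    ∃ (h : H) (k : ℤ), g = hG.inl h * hG.gen ^ k := by
  refine ⟨⟨g.1.left.toAdd, (hG _).1 g.2⟩, g.1.right.toAdd, Subtype.ext ?_⟩
  have h1 : ((hG.gen ^ g.1.right.toAdd : G) : ZSemidirect A) =
      SemidirectProduct.inr g.1.right := by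
    rw [Subgroup.coe_zpow]
    change (SemidirectProduct.inr (Multiplicative.ofAdd 1)) ^ _ = _
    rw [← map_zpow, ← ofAdd_zsmul]
    simp
  rw [Subgroup.coe_mul, h1]
  exact (SemidirectProduct.inl_left_mul_inr_right g.1).symm

end ToCircleAction

theorem mainTheorem3 {d : ℕ} (A : GL (Fin d) ℚ) (hA : NoEigenvalueOfNormOne A)
    (H : AddSubgroup (Fin d → ℚ))
    (hH : Module.finrank ℚ (Submodule.span ℚ (H : Set (Fin d → ℚ))) = d)
    (G : Subgroup (ZSemidirect A)) (hG : IsZSemidirectWith G H)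
    (ρ : G →* DiffOnePlusCircle)
    (hρ : ∃ g h : G, ρ g * ρ h ≠ ρ h * ρ g) :
    (∃ x : UnitAddCircle, (circleOrbit ρ x).Finite) ∧
      ¬ ∃ K : Set UnitAddCircle, IsExceptionalMinimalSet ρ K := by
  have hρeq : ∀ g, ∃ (h : H) (k : ℤ), (ρ g : Equiv.Perm UnitAddCircle) =
      (hG.circleAction ρ).φ h * (hG.circleAction ρ).α ^ k := fun g => by
    obtain ⟨h, k, hg⟩ := hG.exists_eq_mul g
    refine ⟨h, k, ?_⟩
    rw [hg, map_mul, map_zpow, Subgroup.coe_mul, Subgroup.coe_zpow]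
    rfl
  -- The image is generated by `α` and the commuting maps `φ h`; it would be Abelian if `α` commuted
  -- with each of them.
  have hnc : ¬ ∀ h, Commute (hG.circleAction ρ).α ((hG.circleAction ρ).φ h) := by
    intro hc
    obtain ⟨g, g', hgg⟩ := hρ
    refine hgg (Subtype.ext ?_)
    obtain ⟨h, k, hg⟩ := hρeq g
    obtain ⟨h', k', hg'⟩ := hρeq g'
    rw [Subgroup.coe_mul, Subgroup.coe_mul, hg, hg']
    exact (((hG.circleAction ρ).φ_commute h h').mul_right ((hc h).symm.zpow_right k')).mul_left
      (((hc h').zpow_left k).mul_right ((Commute.refl _).zpow_zpow k k'))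
  obtain ⟨x, hx⟩ := (hG.circleAction ρ).exists_finite_orbit hA hH hnc
  have hfin : (circleOrbit ρ x).Finite := by
    refine hx.subset ?_
    rintro _ ⟨g, rfl⟩
    obtain ⟨h, k, hg⟩ := hρeq g
    exact ⟨(h, k), congrArg (fun f : Equiv.Perm UnitAddCircle => f x) hg.symm⟩
  exact ⟨⟨x, hfin⟩, fun ⟨K, hK⟩ => not_isExceptionalMinimalSet_of_finite_orbit hfin K hK⟩
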